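/- Let $n\ge 1$, let $x_1,\dots,x_n\in\mathbb R^2$ be the positions of stationary targets, and let $k,\alpha,h,r_s,d>0$ be constants. For $a\neq b$ in $\mathbb R^2$ let $\varphi(a,b)=(b-a)/\|b-a\|$ be the unit vector from $a$ to $b$, and for a vector $v$ let $\bar v$ be $v$ rotated clockwise by $\pi/2$. Let $u$ be the unit step function, $u(s)=1$ for $s\ge 0$ and $u(s)=0$ for $s<0$. The minimum circle of a finite nonempty set of points is the (unique) circle of least radius that encloses all of them; let $c$ and $r_t$ be the center and the radius of the minimum circle of $\{x_1,\dots,x_n\}$. Let $y(t)\in\mathbb R^2$ be the position of the agent and $\hat\rho_i(t)\in\mathbb R$ the state of the $i$-th dynamic compensator, $t\ge 0$. Put $\rho_i(t)=\|x_i-y(t)\|$, $\varphi_i(t)=\varphi(y(t),x_i)$, $\tilde\rho_i=\hat\rho_i-\rho_i$ and $\hat x_i=y+\hat\rho_i\varphi_i$. Let $\hat c(t)$ and $\hat r_t(t)$ be the center and the radius of the minimum circle of $\{\hat x_1(t),\dots,\hat x_n(t)\}$, and put $\hat\rho=\|\hat c-y\|$, $\hat\varphi=\varphi(y,\hat c)$.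 Suppose that $y$ and the $\hat\rho_i$ are locally absolutely continuous on $[0,\infty)$ and satisfy, for almost every $t>0$, $$\dot{\hat\rho}_i=-\varphi_i^{\mathrm T}\dot y\,u(\hat\rho_i-h)+\operatorname{sgn}(\bar\varphi_i^{\mathrm T}\dot y)\bigl(\bar\varphi_i^{\mathrm T}\dot y+\hat\rho_i\,\bar\varphi_i^{\mathrm T}\dot\varphi_i\bigr)\quad(i=1,\dots,n),$$ $$\dot y=k\bigl[\hat\rho-(\hat r_t+d)\bigr]\hat\varphi+\alpha\,u(\hat\rho-\hat r_t-r_s)\,\bar{\hat\varphi}.$$ Assume that the distance from $y(0)$ to the convex hull of $\{x_1,\dots,x_n\}$ is at least $r_s$, that $h<r_s<d$, and that $h\le\hat\rho_i(0)\le\rho_i(0)$ for all $i$. Then $\lim_{t\to\infty}\tilde\rho_i(t)=0$ and $\lim_{t\to\infty}\hat x_i(t)=x_i$ for every $i$. Moreover, $\lim_{t\to\infty}\|c-y(t)\|=r_t+d$, the function $y$ is differentiable at all sufficiently large $t$, and its tangential speed satisfies $\lim_{t\to\infty}\overline{\varphi(y(t),c)}^{\mathrm T}\dot y(t)=\alpha$.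 -/

import Mathlib

open Filter Topology MeasureTheory
open scoped RealInnerProductSpace

noncomputable section

namespace Circumnavigation

/-- The plane `ℝ²` with its Euclidean norm. -/
abbrev Plane : Type := EuclideanSpace ℝ (Fin 2)

/-- Rotation by `π / 2` clockwise. -/
def rotCW (v : Plane) : Plane := !₂[v 1, -v 0]

/-- The unit step function, with value `1` at `0`. -/
def step (s : ℝ) : ℝ := if 0 ≤ s then 1 else 0

/-- The unit vector pointing from `a` to `b` (for `a ≠ b`). -/
def bearing (a b : Plane) : Plane := ‖b - a‖⁻¹ • (b - a)

section MinimumCircle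

variable {ι : Type*}

/-- The circle with center `c` and radius `r` covers all the points `p i`, and no circle of
smaller radius does. -/
def IsMinCircle (p : ι → Plane) (c : Plane) (r : ℝ) : Prop :=
  (∀ i, dist (p i) c ≤ r) ∧ ∀ (c' : Plane) (r' : ℝ), (∀ i, dist (p i) c' ≤ r') → r ≤ r'

theorem exists_isMinCircle [Finite ι] [Nonempty ι] (p : ι → Plane) :
    ∃ q : Plane × ℝ, IsMinCircle p q.1 q.2 := by
  classical
  have := Fintype.ofFinite ι
  let f : Plane → ℝ := fun c => Finset.univ.sup' Finset.univ_nonempty fun i => dist (p i) c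
  have hf : Continuous f :=
    Continuous.finset_sup'_apply _ fun i _ => continuous_const.dist continuous_id
  have hle : ∀ c i, dist (p i) c ≤ f c := fun c i =>
    Finset.le_sup' (fun i => dist (p i) c) (Finset.mem_univ i)
  obtain ⟨i₀⟩ := ‹Nonempty ι›
  have hlim : Tendsto f (cocompact Plane) atTop :=
    tendsto_atTop_mono (fun c => hle c i₀) (tendsto_dist_left_cocompact_atTop (p i₀))
  obtain ⟨c, hc⟩ := hf.exists_forall_le hlim
  exact ⟨(c, f c), hle c, fun c' r' h =>
    (hc c').trans (Finset.sup'_le _ _ fun i _ => h i)⟩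

theorem IsMinCircle.unique [Finite ι] [Nonempty ι] {p : ι → Plane} {c c' : Plane} {r r' : ℝ}
    (h : IsMinCircle p c r) (h' : IsMinCircle p c' r') : c = c' ∧ r = r' := by
  obtain rfl : r = r' := le_antisymm (h.2 _ _ h'.1) (h'.2 _ _ h.1)
  refine ⟨?_, rfl⟩
  by_contra hne
  have hpos : 0 < ‖c - c'‖ := norm_pos_iff.2 (sub_ne_zero.2 hne)
  obtain ⟨i₀⟩ := ‹Nonempty ι›
  have hr : 0 ≤ r := dist_nonneg.trans (h.1 i₀)
  have key : ∀ i, dist (p i) (midpoint ℝ c c') ≤ √(r ^ 2 - ‖c - c'‖ ^ 2 / 4) := by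
    intro i
    apply Real.le_sqrt_of_sq_le
    have h1 := h.1 i
    have h2 := h'.1 i
    rw [dist_eq_norm] at h1 h2 ⊢
    have e1 : p i - midpoint ℝ c c' = (2⁻¹ : ℝ) • ((p i - c) + (p i - c')) := by
      rw [midpoint_eq_smul_add, invOf_eq_inv]; module
    have e2 : c - c' = (p i - c') - (p i - c) := by abel
    have par := parallelogram_law_with_norm ℝ (p i - c) (p i - c')
    have e3 : ‖c - c'‖ = ‖(p i - c) - (p i - c')‖ := by rw [e2, norm_sub_rev]
    rw [e1, norm_smul, e3, Real.norm_eq_abs, abs_of_pos (by norm_num), mul_pow]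
    have q1 := pow_le_pow_left₀ (norm_nonneg _) h1 2
    have q2 := pow_le_pow_left₀ (norm_nonneg _) h2 2
    linarith
  have hle := h.2 _ _ key
  have hs : √(r ^ 2 - ‖c - c'‖ ^ 2 / 4) < √(r ^ 2) := by
    have hd : ‖c - c'‖ ≤ 2 * r := by
      have t := dist_triangle_left c c' (p i₀)
      rw [dist_eq_norm c c'] at t
      linarith [h.1 i₀, h'.1 i₀]
    exact Real.sqrt_lt_sqrt (by nlinarith) (by nlinarith)
  rw [Real.sqrt_sq hr] at hs
  linarith

variable [Finite ι] [Nonempty ι]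

/-- The center of the minimum circle of the points `p i`. -/
def minCenter (p : ι → Plane) : Plane := (exists_isMinCircle p).choose.1

/-- The radius of the minimum circle of the points `p i`. -/
def minRadius (p : ι → Plane) : ℝ := (exists_isMinCircle p).choose.2

theorem isMinCircle_min (p : ι → Plane) : IsMinCircle p (minCenter p) (minRadius p) :=
  (exists_isMinCircle p).choose_spec

end MinimumCircle

/-- The estimated positions of the targets `x i`, placed in the measured bearings at the
distances `ρh i` from the agent at `y`. -/
def estimate {n : ℕ} (x : Fin n → Plane) (y : Plane) (ρh : Fin n → ℝ) : Fin n → Plane :=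
  fun i => y + ρh i • bearing y (x i)

/-- The velocity prescribed for an agent at `y` by the control protocol, when `xh i` are the
estimated positions of the targets. -/
def protocol {n : ℕ} [NeZero n] (k α rs d : ℝ) (y : Plane) (xh : Fin n → Plane) : Plane :=
  (k * (dist (minCenter xh) y - (minRadius xh + d))) • bearing y (minCenter xh) +
    (α * step (dist (minCenter xh) y - minRadius xh - rs)) • rotCW (bearing y (minCenter xh))

/-- The right-hand side of the dynamic compensator of one target: `φ` and `φ'` are the bearing
of the target and its time derivative, `v` is the velocity of the agent. -/
def compensator (h : ℝ) (φ φ' v : Plane) (ρh : ℝ) : ℝ :=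
  -⟪φ, v⟫ * step (ρh - h) + Real.sign ⟪rotCW φ, v⟫ * (⟪rotCW φ, v⟫ + ρh * ⟪rotCW φ, φ'⟫)

/-- The agent's trajectory `y` and the compensator states `ρh i` are a solution on `[0, ∞)` of
the closed loop of the compensators and the protocol. As the right-hand side is discontinuous,
solutions are taken in the sense of Carathéodory: locally absolutely continuous functions
satisfying the differential equations at almost every time. -/
structure IsSolution {n : ℕ} [NeZero n] (k α rs d h : ℝ) (x : Fin n → Plane)
    (y : ℝ → Plane) (ρh : Fin n → ℝ → ℝ) : Prop where
  absCont_agent : ∀ T > 0, AbsolutelyContinuousOnInterval y 0 T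
  absCont_compensator : ∀ i, ∀ T > 0, AbsolutelyContinuousOnInterval (ρh i) 0 T
  agent : ∀ᵐ t : ℝ, 0 < t →
    HasDerivAt y (protocol k α rs d (y t) (estimate x (y t) fun i => ρh i t)) t
  compensators : ∀ i, ∀ᵐ t : ℝ, 0 < t →
    HasDerivAt (ρh i)
      (compensator h (bearing (y t) (x i)) (deriv (fun s => bearing (y s) (x i)) t)
        (deriv y t) (ρh i t)) t

end Circumnavigation

end

/-! Write ρ_i for the true distance of target i, e_i ≤ 0 for the error (estimated minus true
distance), a_i ≥ 0 for the angular speed of its bearing φ_i. As long as the hull of the targets is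
at distance at least `h`, each estimate stays between `h` and ρ_i, and e_i' = -a_i e_i.
Underestimation makes the agent at least as far from the hull as from the estimated minimum disc; so
within `rs` of the hull the tangential control is off and the agent retreats. These two invariances
support each other (`IsSolution.le_hullDist`). The error is then nondecreasing and converges. The
estimated target x_i + e_i φ_i moves at speed at most 2 e_i', so its path has finite length and it
converges to some p_i, not yet known to be x_i (`IsSolution.dist_estimate_le`). The minimum circle
depends continuously on its points, so asymptotically the agent goes around a fixed circle: its
distance from the center settles and its velocity approaches α times the tangential unit vector
(`tendsto_dist_of_circling`, `tendsto_circlingVelocity_sub`). If e_i had a nonzero limit, φ_i, the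
quotient of two convergent quantities, would converge, and the bounded trajectory would approach a
fixed line through x_i. Perpetual circling forbids this (`not_tendsto_inner_of_circling`). Hence all
errors vanish, p = x, and the limit circle is that of the true targets. -/

noncomputable section

namespace Circumnavigation

/-! ### Absolutely continuous functions and differential inequalities holding almost everywhere. -/

section LocallyAbsolutelyContinuous

/-- Local absolute continuity on `[0, ∞)`. -/
def LocAC {X : Type*} [PseudoMetricSpace X] (f : ℝ → X) : Prop :=
  ∀ T > 0, AbsolutelyContinuousOnInterval f 0 T

theorem absolutelyContinuousOnInterval_of_dist_le {X Y : Type*} [PseudoMetricSpace X]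
    [PseudoMetricSpace Y] {f : ℝ → X} {g : ℝ → Y} {a b C : ℝ}
    (hf : AbsolutelyContinuousOnInterval f a b)
    (h : ∀ s ∈ Set.uIcc a b, ∀ t ∈ Set.uIcc a b, dist (g s) (g t) ≤ C * dist (f s) (f t)) :
    AbsolutelyContinuousOnInterval g a b := by
  have h0 := Filter.Tendsto.const_mul C hf
  rw [mul_zero] at h0
  refine squeeze_zero' (Eventually.of_forall fun E => Finset.sum_nonneg fun i _ => dist_nonneg)
    ?_ h0
  have : ∀ᶠ E in AbsolutelyContinuousOnInterval.totalLengthFilter ⊓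
      𝓟 (AbsolutelyContinuousOnInterval.disjWithin a b),
      E ∈ AbsolutelyContinuousOnInterval.disjWithin a b :=
    eventually_inf_principal.2 (Eventually.of_forall fun _ h => h)
  filter_upwards [this] with E hE
  rw [Finset.mul_sum]
  exact Finset.sum_le_sum fun i hi => h _ (hE.1 i hi).1 _ (hE.1 i hi).2

variable {X Y : Type*} [PseudoMetricSpace X] [PseudoMetricSpace Y]

theorem LocAC.mono {f : ℝ → X} (hf : LocAC f) {a b : ℝ} (ha : 0 ≤ a) (hab : a ≤ b) :
    AbsolutelyContinuousOnInterval f a b := by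
  refine (hf (b + 1) (by linarith)).mono ?_
  rw [Set.uIcc_of_le hab, Set.uIcc_of_le (by linarith)]
  exact Set.Icc_subset_Icc ha (by linarith)

theorem LocAC.of_dist_le {f : ℝ → X} {g : ℝ → Y} (hf : LocAC f) (C : ℝ)
    (h : ∀ s, 0 ≤ s → ∀ t, 0 ≤ t → dist (g s) (g t) ≤ C * dist (f s) (f t)) : LocAC g := by
  intro T hT
  refine absolutelyContinuousOnInterval_of_dist_le (hf T hT) (C := C) fun s hs t ht => ?_
  rw [Set.uIcc_of_le hT.le] at hs ht
  exact h s hs.1 t ht.1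

theorem LocAC.continuousOn {E : Type*} [SeminormedAddCommGroup E] {f : ℝ → E} (hf : LocAC f) :
    ContinuousOn f (Set.Ici 0) := by
  have key : ∀ t : ℝ, 0 ≤ t → ContinuousWithinAt f (Set.Ici 0) t := by
    intro t ht
    have h1 := (hf.mono le_rfl (show 0 ≤ t + 1 by linarith)).continuousOn
    rw [Set.uIcc_of_le (show 0 ≤ t + 1 by linarith)] at h1
    have h2 := h1 t ⟨ht, by linarith⟩
    rw [← Set.Ici_inter_Iic] at h2
    exact (continuousWithinAt_inter (Iic_mem_nhds (by linarith))).1 h2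
  exact fun t ht => key t ht

theorem LocAC.continuousAt {E : Type*} [SeminormedAddCommGroup E] {f : ℝ → E} (hf : LocAC f)
    {t : ℝ} (ht : 0 < t) : ContinuousAt f t :=
  hf.continuousOn.continuousAt (Ici_mem_nhds ht)

theorem LocAC.ae_differentiableAt {f : ℝ → ℝ} (hf : LocAC f) :
    ∀ᵐ t : ℝ, 0 < t → DifferentiableAt ℝ f t := by
  have h : ∀ᵐ t : ℝ, ∀ n : ℕ, t ∈ Set.uIcc (0 : ℝ) (n + 1) → DifferentiableAt ℝ f t :=
    ae_all_iff.2 fun n => (hf (n + 1) (by positivity)).ae_differentiableAt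
  filter_upwards [h] with t ht h0
  obtain ⟨n, hn⟩ := exists_nat_ge t
  refine ht n ?_
  rw [Set.uIcc_of_le (by positivity)]
  exact ⟨h0.le, by linarith⟩

theorem le_of_ae_deriv_nonneg {f : ℝ → ℝ} {a b : ℝ} (hab : a ≤ b)
    (hf : AbsolutelyContinuousOnInterval f a b)
    (h : ∀ᵐ t : ℝ, a < t → t < b → 0 ≤ deriv f t) : f a ≤ f b := by
  have h1 := hf.integral_deriv_eq_sub
  have hb : ∀ᵐ t : ℝ, t ≠ b := by simp [ae_iff, measure_singleton]
  have h2 : 0 ≤ ∫ t in a..b, deriv f t := by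
    rw [intervalIntegral.integral_of_le hab]
    refine setIntegral_nonneg_of_ae_restrict ?_
    filter_upwards [(ae_restrict_iff' measurableSet_Ioc).2 (Eventually.of_forall fun _ h => h),
      ae_restrict_of_ae h, ae_restrict_of_ae hb] with t ht h1 h2
    exact h1 ht.1 (lt_of_le_of_ne ht.2 h2)
  linarith

/-- A locally absolutely continuous function that does not decrease as long as it is below `K`
stays above `K`. -/
theorem barrier {f : ℝ → ℝ} {K T : ℝ} (hf : LocAC f) (h0 : K ≤ f 0)
    (h : ∀ᵐ t : ℝ, 0 < t → t < T → f t < K → 0 ≤ deriv f t) {t : ℝ} (ht0 : 0 ≤ t) (htT : t ≤ T) :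
    K ≤ f t := by
  by_contra hlt
  push Not at hlt
  have hc : ContinuousOn f (Set.Icc 0 t) := hf.continuousOn.mono fun s hs => hs.1
  have hS : IsCompact (Set.Icc 0 t ∩ f ⁻¹' Set.Ici K) :=
    isCompact_Icc.of_isClosed_subset (hc.preimage_isClosed_of_isClosed isClosed_Icc isClosed_Ici)
      Set.inter_subset_left
  -- `s` is the last time up to `t` with `K ≤ f s`; afterwards `f` is below `K`, hence does not
  -- decrease.
  obtain ⟨s, hs, hmax⟩ := hS.exists_isGreatest ⟨0, ⟨le_rfl, ht0⟩, h0⟩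
  have hle : f s ≤ f t := by
    refine le_of_ae_deriv_nonneg hs.1.2 (hf.mono hs.1.1 hs.1.2) ?_
    filter_upwards [h] with u hu hsu hut
    refine hu (hs.1.1.trans_lt hsu) (hut.trans_le htT) ?_
    by_contra hK
    exact absurd (hmax ⟨⟨hs.1.1.trans hsu.le, hut.le⟩, not_lt.1 hK⟩) (not_le.2 hsu)
  exact absurd (hs.2.trans hle) (not_le.2 hlt)

theorem LocAC.mul {f g : ℝ → ℝ} (hf : LocAC f) (hg : LocAC g) : LocAC fun t => f t * g t :=
  fun T hT => (hf T hT).fun_mul (hg T hT)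

theorem LocAC.sub {E : Type*} [SeminormedAddCommGroup E] {f g : ℝ → E} (hf : LocAC f)
    (hg : LocAC g) : LocAC fun t => f t - g t :=
  fun T hT => (hf T hT).fun_sub (hg T hT)

theorem LocAC.neg {E : Type*} [SeminormedAddCommGroup E] {f : ℝ → E} (hf : LocAC f) :
    LocAC fun t => -f t :=
  fun T hT => (hf T hT).fun_neg

theorem _root_.ContDiff.locAC {E : Type*} [NormedAddCommGroup E] [NormedSpace ℝ E] {f : ℝ → E}
    (hf : ContDiff ℝ 1 f) : LocAC f :=
  fun _ _ => hf.contDiffOn.absolutelyContinuousOnInterval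

theorem LocAC.const_mul {f : ℝ → ℝ} (hf : LocAC f) (c : ℝ) : LocAC fun t => c * f t :=
  fun T hT => (hf T hT).const_mul c

theorem LocAC.inner_const {E : Type*} [NormedAddCommGroup E] [InnerProductSpace ℝ E]
    {f : ℝ → E} (hf : LocAC f) (w : E) : LocAC fun t => ⟪w, f t⟫ := by
  refine hf.of_dist_le ‖w‖ fun s _ t _ => ?_
  rw [Real.dist_eq, ← inner_sub_right, dist_eq_norm]
  exact abs_real_inner_le_norm _ _

/-- If `f' + k f → 0` then eventually `f ≤ ε`. -/
theorem eventually_le_of_deriv_add_mul_tendsto {f F : ℝ → ℝ} {k T₀ : ℝ} (hk : 0 < k) (hf : LocAC f)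
    (hF : ∀ᵐ t : ℝ, T₀ < t → HasDerivAt f (F t) t)
    (hlim : Tendsto (fun t => F t + k * f t) atTop (𝓝 0)) {ε : ℝ} (hε : 0 < ε) :
    ∀ᶠ t in atTop, f t ≤ ε := by
  have h1 : ∀ᶠ t in atTop, F t + k * f t < k * (ε / 2) :=
    hlim.eventually_lt_const (by positivity)
  obtain ⟨T, hT⟩ := eventually_atTop.1
    (h1.and ((eventually_gt_atTop 0).and (eventually_ge_atTop T₀)))
  have hTpos : 0 < T := (hT T le_rfl).2.1
  -- Integrating factor: `g' = exp (k t) (k ε / 2 - (F + k f))`, which is nonnegative from `T` on.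
  set g : ℝ → ℝ := fun t => Real.exp (k * t) * (ε / 2 - f t) with hg
  have hgac : LocAC g := by
    have e1 : ContDiff ℝ 1 fun t : ℝ => Real.exp (k * t) := by fun_prop
    have e2 : ContDiff ℝ 1 fun _ : ℝ => ε / 2 := by fun_prop
    exact e1.locAC.mul (e2.locAC.sub hf)
  have hmono : ∀ t, T ≤ t → g T ≤ g t := fun t ht => by
    refine le_of_ae_deriv_nonneg ht (hgac.mono hTpos.le ht) ?_
    filter_upwards [hF] with s hs h2 _
    have d1 : HasDerivAt (fun t : ℝ => Real.exp (k * t)) (Real.exp (k * s) * (k * 1)) s :=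
      ((hasDerivAt_id s).const_mul k).exp
    have d2 := d1.mul ((hs ((hT T le_rfl).2.2.trans_lt h2)).const_sub (ε / 2))
    have d3 : deriv g s = _ := d2.deriv
    rw [d3]
    have := (hT s h2.le).1
    have e := Real.exp_pos (k * s)
    have : Real.exp (k * s) * (k * 1) * (ε / 2 - f s) + Real.exp (k * s) * (-F s) =
        Real.exp (k * s) * (k * (ε / 2) - (F s + k * f s)) := by ring
    rw [this]
    exact mul_nonneg e.le (by linarith)
  have hdec : Tendsto (fun t => Real.exp (-(k * t)) * (-g T)) atTop (𝓝 0) := by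
    have : Tendsto (fun t : ℝ => Real.exp (-(k * t))) atTop (𝓝 0) :=
      Real.tendsto_exp_neg_atTop_nhds_zero.comp (tendsto_id.const_mul_atTop hk)
    simpa using this.mul_const (-g T)
  filter_upwards [hdec.eventually_lt_const (half_pos hε), eventually_ge_atTop T] with t h2 h3
  have h4 := hmono t h3
  have h5 : Real.exp (-(k * t)) * (-g t) = f t - ε / 2 := by
    rw [hg]
    have : Real.exp (-(k * t)) * Real.exp (k * t) = 1 := by rw [← Real.exp_add]; simp
    linear_combination (f t - ε / 2) * this
  have h6 : Real.exp (-(k * t)) * (-g t) ≤ Real.exp (-(k * t)) * (-g T) :=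
    mul_le_mul_of_nonneg_left (by linarith) (Real.exp_pos _).le
  linarith

theorem tendsto_zero_of_deriv_add_mul_tendsto {f F : ℝ → ℝ} {k T₀ : ℝ} (hk : 0 < k) (hf : LocAC f)
    (hF : ∀ᵐ t : ℝ, T₀ < t → HasDerivAt f (F t) t)
    (hlim : Tendsto (fun t => F t + k * f t) atTop (𝓝 0)) : Tendsto f atTop (𝓝 0) := by
  rw [Metric.tendsto_nhds]
  intro ε hε
  have h1 := eventually_le_of_deriv_add_mul_tendsto hk hf hF hlim (half_pos hε)
  have h2 := eventually_le_of_deriv_add_mul_tendsto (f := fun t => -f t) (F := fun t => -F t)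
    hk hf.neg (hF.mono fun t h ht => (h ht).neg)
    (by
      have := hlim.neg
      rw [neg_zero] at this
      exact this.congr fun t => by ring) (half_pos hε)
  filter_upwards [h1, h2] with t h1 h2
  rw [Real.dist_eq, sub_zero, abs_lt]
  constructor <;> linarith

/-- The derivative of a bounded function has no positive limit. -/
theorem not_pos_deriv_limit {f F : ℝ → ℝ} {L B : ℝ} (hf : LocAC f)
    (hF : ∀ᵐ t : ℝ, 0 < t → HasDerivAt f (F t) t) (hlim : Tendsto F atTop (𝓝 L))
    (hB : ∀ t, 0 ≤ t → |f t| ≤ B) : L ≤ 0 := by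
  by_contra hL
  push Not at hL
  obtain ⟨T, hT⟩ := eventually_atTop.1
    ((hlim.eventually_const_lt (half_lt_self hL)).and (eventually_gt_atTop 0))
  have hTpos : 0 < T := (hT T le_rfl).2
  have hB0 : 0 ≤ B := (abs_nonneg _).trans (hB 0 le_rfl)
  -- With slope at least `L / 2`, the gain over `[T, S]` is at least `2 * B + 1`, more than the
  -- bound `B` permits.
  set S := T + (2 * B + 1) / (L / 2) with hS
  have hTS : T ≤ S := by rw [hS]; have : 0 < (2 * B + 1) / (L / 2) := by positivity
                         linarith
  have hlin : LocAC fun t : ℝ => L / 2 * t := by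
    have : ContDiff ℝ 1 fun t : ℝ => L / 2 * t := by fun_prop
    exact this.locAC
  have key : f T - L / 2 * T ≤ f S - L / 2 * S := by
    refine le_of_ae_deriv_nonneg (f := fun t => f t - L / 2 * t) hTS
      ((hf.sub hlin).mono hTpos.le hTS) ?_
    filter_upwards [hF] with s hs h2 _
    have d := (hs (hTpos.trans h2)).sub ((hasDerivAt_id s).const_mul (L / 2))
    have d3 : deriv (fun t => f t - L / 2 * t) s = _ := d.deriv
    rw [d3]
    have := (hT s h2.le).1
    linarith
  have e : L / 2 * (S - T) = 2 * B + 1 := by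
    rw [hS]; field_simp; ring
  have b1 := abs_le.1 (hB T hTpos.le)
  have b2 := abs_le.1 (hB S (hTpos.le.trans hTS))
  linarith [b1.1, b2.2]

theorem deriv_limit_eq_zero {f F : ℝ → ℝ} {L B : ℝ} (hf : LocAC f)
    (hF : ∀ᵐ t : ℝ, 0 < t → HasDerivAt f (F t) t) (hlim : Tendsto F atTop (𝓝 L))
    (hB : ∀ t, 0 ≤ t → |f t| ≤ B) : L = 0 := by
  refine le_antisymm (not_pos_deriv_limit hf hF hlim hB) ?_
  have := not_pos_deriv_limit (f := fun t => -f t) (F := fun t => -F t) hf.neg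
    (hF.mono fun t h ht => (h ht).neg) hlim.neg (fun t ht => by rw [abs_neg]; exact hB t ht)
  linarith

/-- A locally absolutely continuous function whose derivative agrees almost everywhere after time
`T` with a function continuous after time `T` is differentiable after time `T`. -/
theorem hasDerivAt_of_ae_hasDerivAt {f F : ℝ → ℝ} {T : ℝ} (hT : 0 ≤ T) (hf : LocAC f)
    (hF : ∀ᵐ t : ℝ, T < t → HasDerivAt f (F t) t) (hc : ContinuousOn F (Set.Ioi T)) {t : ℝ}
    (ht : T < t) : HasDerivAt f (F t) t := by
  obtain ⟨a, hTa, hat⟩ := exists_between ht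
  have hint : ∀ s, a ≤ s → f s = f a + ∫ u in a..s, F u := by
    intro s has
    have h1 := (hf.mono (hT.trans hTa.le) has).integral_deriv_eq_sub
    have h2 : ∫ u in a..s, deriv f u = ∫ u in a..s, F u := by
      refine intervalIntegral.integral_congr_ae ?_
      filter_upwards [hF] with u hu hua
      rw [Set.uIoc_of_le has] at hua
      exact (hu (hTa.trans hua.1)).deriv
    linarith
  have hFc : ContinuousAt F t := hc.continuousAt (Ioi_mem_nhds ht)
  have hii : IntervalIntegrable F volume a t := by
    refine (hc.mono ?_).intervalIntegrable
    rw [Set.uIcc_of_le hat.le]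
    exact fun u hu => hTa.trans_le hu.1
  have hd := intervalIntegral.integral_hasDerivAt_right hii
    (hc.stronglyMeasurableAtFilter isOpen_Ioi t ht) hFc
  refine (hd.const_add (f a)).congr_of_eventuallyEq ?_
  filter_upwards [Ioi_mem_nhds hat] with s hs
  exact hint s (le_of_lt hs)

end LocallyAbsolutelyContinuous

/-! ### Algebra of the clockwise rotation. -/

section Rotation

theorem inner_eq_coord (u v : Plane) : ⟪u, v⟫ = u 0 * v 0 + u 1 * v 1 := by
  simp [PiLp.inner_apply, Fin.sum_univ_two, mul_comm]

@[simp] theorem rotCW_apply_zero (v : Plane) : rotCW v 0 = v 1 := by simp [rotCW]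

@[simp] theorem rotCW_apply_one (v : Plane) : rotCW v 1 = -v 0 := by simp [rotCW]

theorem rotCW_sub (u v : Plane) : rotCW (u - v) = rotCW u - rotCW v := by
  ext i; fin_cases i
  · simp
  · simp; ring

theorem rotCW_smul (a : ℝ) (v : Plane) : rotCW (a • v) = a • rotCW v := by
  ext i; fin_cases i <;> simp

theorem inner_rotCW_rotCW (u v : Plane) : ⟪rotCW u, rotCW v⟫ = ⟪u, v⟫ := by
  simp only [inner_eq_coord, rotCW_apply_zero, rotCW_apply_one]; ring

theorem inner_rotCW_left (u v : Plane) : ⟪rotCW u, v⟫ = -⟪u, rotCW v⟫ := by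
  simp only [inner_eq_coord, rotCW_apply_zero, rotCW_apply_one]; ring

@[simp] theorem inner_rotCW_self (v : Plane) : ⟪rotCW v, v⟫ = 0 := by
  simp only [inner_eq_coord, rotCW_apply_zero, rotCW_apply_one]; ring

@[simp] theorem inner_self_rotCW (v : Plane) : ⟪v, rotCW v⟫ = 0 := by
  rw [real_inner_comm, inner_rotCW_self]

@[simp] theorem norm_rotCW (v : Plane) : ‖rotCW v‖ = ‖v‖ := by
  rw [← sq_eq_sq₀ (norm_nonneg _) (norm_nonneg _), ← real_inner_self_eq_norm_sq,
    ← real_inner_self_eq_norm_sq, inner_rotCW_rotCW]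

theorem continuous_rotCW : Continuous rotCW :=
  (Isometry.of_dist_eq fun u v => by
    rw [dist_eq_norm, dist_eq_norm, ← rotCW_sub, norm_rotCW]).continuous

theorem norm_sq_smul_eq (φ v : Plane) :
    (‖φ‖ ^ 2) • v = ⟪φ, v⟫ • φ + ⟪rotCW φ, v⟫ • rotCW φ := by
  have e : ‖φ‖ ^ 2 = φ 0 * φ 0 + φ 1 * φ 1 := by
    rw [← real_inner_self_eq_norm_sq, inner_eq_coord]
  rw [e, inner_eq_coord, inner_eq_coord]
  ext i; fin_cases i <;> simp <;> ring

theorem inner_sq_add_inner_rotCW_sq (w z : Plane) :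
    ⟪w, z⟫ ^ 2 + ⟪rotCW w, z⟫ ^ 2 = ‖w‖ ^ 2 * ‖z‖ ^ 2 := by
  rw [← real_inner_self_eq_norm_sq, ← real_inner_self_eq_norm_sq]
  simp only [inner_eq_coord, rotCW_apply_zero, rotCW_apply_one]; ring

end Rotation

/-! ### Bearings: Lipschitz bounds, derivatives, and the compensator equation. -/

section Bearing

theorem norm_bearing_le (a b : Plane) : ‖bearing a b‖ ≤ 1 := by
  rw [bearing, norm_smul, norm_inv, norm_norm]
  exact inv_mul_le_one

theorem norm_bearing {a b : Plane} (h : a ≠ b) : ‖bearing a b‖ = 1 := by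
  rw [bearing, norm_smul, norm_inv, norm_norm]
  exact inv_mul_cancel₀ (norm_ne_zero_iff.2 (sub_ne_zero.2 h.symm))

theorem dist_smul_bearing (a b : Plane) : dist b a • bearing a b = b - a := by
  rw [bearing, dist_eq_norm, smul_smul]
  rcases eq_or_ne (b - a) 0 with h | h
  · simp [h]
  · rw [mul_inv_cancel₀ (norm_ne_zero_iff.2 h), one_smul]

/-- Of the factor 2, one half pays for the change of the vector, the other for the change of its
length. Nothing is asked of `a'` and `b'`, since a degenerate bearing is zero. -/
theorem dist_bearing_le {a a' b b' : Plane} (h : a ≠ b) :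
    ‖bearing a b - bearing a' b'‖ ≤ 2 * (dist b a)⁻¹ * ‖(b - a) - (b' - a')‖ := by
  have hpos : 0 < dist b a := dist_pos.2 h.symm
  have e1 := dist_smul_bearing a b
  have e2 := dist_smul_bearing a' b'
  have e3 : dist b a • (bearing a b - bearing a' b') =
      ((b - a) - (b' - a')) + (dist b' a' - dist b a) • bearing a' b' := by
    rw [smul_sub, sub_smul, e1, e2]; abel
  have e4 : |dist b' a' - dist b a| ≤ ‖(b - a) - (b' - a')‖ := by
    rw [dist_eq_norm, dist_eq_norm, norm_sub_rev (b - a)]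
    exact abs_norm_sub_norm_le _ _
  have e5 : dist b a * ‖bearing a b - bearing a' b'‖ ≤ 2 * ‖(b - a) - (b' - a')‖ := by
    calc dist b a * ‖bearing a b - bearing a' b'‖
        = ‖dist b a • (bearing a b - bearing a' b')‖ := by
          rw [norm_smul, Real.norm_eq_abs, abs_of_pos hpos]
      _ ≤ ‖(b - a) - (b' - a')‖ + |dist b' a' - dist b a| * ‖bearing a' b'‖ := by
          rw [e3]
          refine (norm_add_le _ _).trans ?_
          rw [norm_smul, Real.norm_eq_abs]
      _ ≤ 2 * ‖(b - a) - (b' - a')‖ := by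
          have := mul_le_mul e4 (norm_bearing_le a' b') (norm_nonneg _) (norm_nonneg _)
          linarith
  calc ‖bearing a b - bearing a' b'‖
      = (dist b a)⁻¹ * (dist b a * ‖bearing a b - bearing a' b'‖) := by
        rw [← mul_assoc, inv_mul_cancel₀ hpos.ne', one_mul]
    _ ≤ (dist b a)⁻¹ * (2 * ‖(b - a) - (b' - a')‖) :=
        mul_le_mul_of_nonneg_left e5 (inv_nonneg.2 hpos.le)
    _ = _ := by ring

theorem continuousAt_bearing {a b : Plane} (h : a ≠ b) :
    ContinuousAt (fun q : Plane × Plane => bearing q.1 q.2) (a, b) := by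
  unfold bearing
  have : ‖b - a‖ ≠ 0 := norm_ne_zero_iff.2 (sub_ne_zero.2 h.symm)
  have h1 : ContinuousAt (fun q : Plane × Plane => q.2 - q.1) (a, b) := by fun_prop
  exact (h1.norm.inv₀ this).smul h1

theorem hasDerivAt_dist {y : ℝ → Plane} {v b : Plane} {t : ℝ} (hy : HasDerivAt y v t)
    (h : y t ≠ b) : HasDerivAt (fun s => dist b (y s)) (-⟪bearing (y t) b, v⟫) t := by
  have h1 : HasDerivAt (fun s => b - y s) (-v) t := hy.const_sub b
  have hne : ‖b - y t‖ ≠ 0 := norm_ne_zero_iff.2 (sub_ne_zero.2 h.symm)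
  have h2 := h1.norm_sq.sqrt (pow_ne_zero 2 hne)
  have h3 : (fun s => dist b (y s)) = fun s => √(‖b - y s‖ ^ 2) := by
    funext s; rw [Real.sqrt_sq (norm_nonneg _), dist_eq_norm]
  rw [h3]
  convert h2 using 1
  rw [Real.sqrt_sq (norm_nonneg _), bearing, inner_smul_left, inner_neg_right]
  simp only [conj_trivial]
  field_simp

theorem hasDerivAt_bearing {y : ℝ → Plane} {v b : Plane} {t : ℝ} (hy : HasDerivAt y v t)
    (h : y t ≠ b) :
    HasDerivAt (fun s => bearing (y s) b)
      (-(⟪rotCW (bearing (y t) b), v⟫ / dist b (y t)) • rotCW (bearing (y t) b)) t := by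
  have h1 : HasDerivAt (fun s => b - y s) (-v) t := hy.const_sub b
  have hne : dist b (y t) ≠ 0 := dist_ne_zero.2 h.symm
  have h2 := ((hasDerivAt_dist hy h).inv hne).smul h1
  have h3 : (fun s => bearing (y s) b) = (fun s => dist b (y s))⁻¹ • fun s => b - y s := by
    funext s; simp [bearing, dist_eq_norm]
  rw [h3]
  have e := norm_sq_smul_eq (bearing (y t) b) v
  rw [norm_bearing h, one_pow, one_smul] at e
  suffices hs : -(⟪rotCW (bearing (y t) b), v⟫ / dist b (y t)) • rotCW (bearing (y t) b) =
      (fun s => dist b (y s))⁻¹ t • -v +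
        (- -⟪bearing (y t) b, v⟫ / dist b (y t) ^ 2) • (b - y t) by
    rw [hs]; exact h2
  rw [Pi.inv_apply, ← dist_smul_bearing (y t) b]
  set φ := bearing (y t) b
  set ρ := dist b (y t)
  have e4 : (ρ⁻¹ • -v : Plane) = -(ρ⁻¹ * ⟪φ, v⟫) • φ - (ρ⁻¹ * ⟪rotCW φ, v⟫) • rotCW φ := by
    nth_rewrite 1 [e]
    module
  have e5 : -(-⟪φ, v⟫) / ρ ^ 2 * ρ = ρ⁻¹ * ⟪φ, v⟫ := by field_simp
  rw [e4, smul_smul, e5, div_eq_inv_mul]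
  module

/-- The bearing turns at rate `-⟪rotCW φ, v⟫ / dist`, so the last factor of the compensator is
`⟪rotCW φ, v⟫ / dist * (dist - ρ)`, and the sign turns its coefficient into an absolute value: a
pull towards the true distance at the angular speed of the bearing. -/
theorem compensator_eq {y : ℝ → Plane} {v b : Plane} {t h ρ : ℝ} (hy : HasDerivAt y v t)
    (hne : y t ≠ b) :
    compensator h (bearing (y t) b) (deriv (fun s => bearing (y s) b) t) (deriv y t) ρ =
      -⟪bearing (y t) b, v⟫ * step (ρ - h) +
        |⟪rotCW (bearing (y t) b), v⟫| / dist b (y t) * (dist b (y t) - ρ) := by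
  rw [compensator, (hasDerivAt_bearing hy hne).deriv, hy.deriv, inner_smul_right,
    real_inner_self_eq_norm_sq, norm_rotCW, norm_bearing hne]
  have hne' : dist b (y t) ≠ 0 := dist_ne_zero.2 hne.symm
  congr 1
  have hs : ∀ a : ℝ, Real.sign a * a = |a| := fun a => by
    rcases lt_trichotomy a 0 with ha | rfl | ha
    · rw [Real.sign_of_neg ha, abs_of_neg ha]; ring
    · simp
    · rw [Real.sign_of_pos ha, abs_of_pos ha]; ring
  rw [← hs]
  field_simp
  ring

end Bearing

/-! ### Stability of the minimum circle. -/

section MinimumCircle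

variable {ι : Type*} [Finite ι] [Nonempty ι]

theorem dist_minCenter_le (p : ι → Plane) (i : ι) : dist (p i) (minCenter p) ≤ minRadius p :=
  (isMinCircle_min p).1 i

theorem minRadius_nonneg (p : ι → Plane) : 0 ≤ minRadius p :=
  dist_nonneg.trans (dist_minCenter_le p (Classical.arbitrary ι))

theorem minRadius_le_add {p q : ι → Plane} {ε : ℝ} (h : ∀ i, dist (p i) (q i) ≤ ε) :
    minRadius p ≤ minRadius q + ε :=
  (isMinCircle_min p).2 (minCenter q) _ fun i => by
    have := dist_triangle (p i) (q i) (minCenter q)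
    linarith [h i, dist_minCenter_le q i]

/-- Quantitative uniqueness: by the parallelogram law the midpoint of the two centers covers the
points with a squared radius smaller than the mean of the squares by a quarter of the squared
distance of the centers. -/
theorem norm_minCenter_sub_sq_le (p : ι → Plane) {c : Plane} {r : ℝ}
    (h : ∀ i, dist (p i) c ≤ r) :
    ‖minCenter p - c‖ ^ 2 ≤ 2 * (r ^ 2 - minRadius p ^ 2) := by
  have key : ∀ i, dist (p i) (midpoint ℝ (minCenter p) c) ≤
      √((minRadius p ^ 2 + r ^ 2) / 2 - ‖minCenter p - c‖ ^ 2 / 4) := by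
    intro i
    apply Real.le_sqrt_of_sq_le
    have h1 := dist_minCenter_le p i
    have h2 := h i
    rw [dist_eq_norm] at h1 h2 ⊢
    have e1 : p i - midpoint ℝ (minCenter p) c =
        (2⁻¹ : ℝ) • ((p i - minCenter p) + (p i - c)) := by
      rw [midpoint_eq_smul_add, invOf_eq_inv]; module
    have par := parallelogram_law_with_norm ℝ (p i - minCenter p) (p i - c)
    have e3 : ‖minCenter p - c‖ = ‖(p i - minCenter p) - (p i - c)‖ := by
      rw [norm_sub_rev]; congr 1; abel
    rw [e1, norm_smul, e3, Real.norm_eq_abs, abs_of_pos (by norm_num), mul_pow]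
    have q1 := pow_le_pow_left₀ (norm_nonneg _) h1 2
    have q2 := pow_le_pow_left₀ (norm_nonneg _) h2 2
    linarith
  have hle := (isMinCircle_min p).2 _ _ key
  have h0 : 0 ≤ (minRadius p ^ 2 + r ^ 2) / 2 - ‖minCenter p - c‖ ^ 2 / 4 := by
    have i : ι := Classical.arbitrary ι
    have t := dist_triangle_left (minCenter p) c (p i)
    rw [dist_eq_norm (minCenter p) c] at t
    have t2 : ‖minCenter p - c‖ ≤ minRadius p + r := by
      linarith [h i, dist_minCenter_le p i]
    have := pow_le_pow_left₀ (norm_nonneg _) t2 2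
    nlinarith [sq_nonneg (minRadius p - r)]
  have := pow_le_pow_left₀ (minRadius_nonneg p) hle 2
  rw [Real.sq_sqrt h0] at this
  linarith

theorem continuous_minRadius : Continuous (minRadius : (ι → Plane) → ℝ) := by
  have := Fintype.ofFinite ι
  rw [Metric.continuous_iff]
  intro q ε hε
  refine ⟨ε / 2, half_pos hε, fun p hp => ?_⟩
  have h1 : minRadius p ≤ minRadius q + ε / 2 :=
    minRadius_le_add fun i => (dist_le_pi_dist p q i).trans hp.le
  have h2 : minRadius q ≤ minRadius p + ε / 2 :=
    minRadius_le_add fun i => (dist_le_pi_dist q p i).trans (by rw [dist_comm]; exact hp.le)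
  rw [Real.dist_eq, abs_lt]
  constructor <;> linarith

theorem continuous_minCenter : Continuous (minCenter : (ι → Plane) → Plane) := by
  have := Fintype.ofFinite ι
  rw [continuous_iff_continuousAt]
  intro q
  rw [ContinuousAt, tendsto_iff_norm_sub_tendsto_zero]
  have hb : Tendsto (fun p : ι → Plane => √(2 * ((minRadius p + dist p q) ^ 2 - minRadius q ^ 2)))
      (𝓝 q) (𝓝 0) := by
    have hc : Continuous fun p : ι → Plane =>
        √(2 * ((minRadius p + dist p q) ^ 2 - minRadius q ^ 2)) := by
      have := continuous_minRadius (ι := ι)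
      fun_prop
    have := hc.tendsto q
    simpa using this
  refine squeeze_zero (fun _ => norm_nonneg _) (fun p => ?_) hb
  apply Real.le_sqrt_of_sq_le
  rw [norm_sub_rev]
  -- The center for `p`, with radius enlarged by `dist p q`, covers `q`.
  refine norm_minCenter_sub_sq_le q fun i => ?_
  have t := dist_triangle (q i) (p i) (minCenter p)
  have h2 := dist_le_pi_dist p q i
  rw [dist_comm (p i)] at h2
  linarith [dist_minCenter_le p i]

/-- The center of the minimum circle lies in every half-plane containing the points. -/
theorem le_inner_minCenter (p : ι → Plane) {e y : Plane} {δ : ℝ} (he : ‖e‖ = 1)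
    (h : ∀ i, δ ≤ ⟪e, p i - y⟫) : δ ≤ ⟪e, minCenter p - y⟫ := by
  by_contra hlt
  push Not at hlt
  -- Moving the center by `s` along `e` increases no distance to the points, so it yields a second
  -- minimum circle.
  set s := δ - ⟪e, minCenter p - y⟫ with hs
  have hspos : 0 < s := by linarith
  have hcov : ∀ i, dist (p i) (minCenter p + s • e) ≤ minRadius p := by
    intro i
    refine le_trans ?_ (dist_minCenter_le p i)
    rw [dist_eq_norm, dist_eq_norm]
    refine (sq_le_sq₀ (norm_nonneg _) (norm_nonneg _)).1 ?_
    have e1 : p i - (minCenter p + s • e) = (p i - minCenter p) - s • e := by abel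
    have e2 : ⟪p i - minCenter p, e⟫ = ⟪e, p i - y⟫ - ⟪e, minCenter p - y⟫ := by
      rw [real_inner_comm, ← inner_sub_right]; congr 1; abel
    rw [e1, norm_sub_sq_real, norm_smul, he, inner_smul_right, e2, Real.norm_eq_abs, mul_one,
      sq_abs]
    have : s ≤ ⟪e, p i - y⟫ - ⟪e, minCenter p - y⟫ := by linarith [h i]
    nlinarith
  have hmin : IsMinCircle p (minCenter p + s • e) (minRadius p) :=
    ⟨hcov, (isMinCircle_min p).2⟩
  have := ((isMinCircle_min p).unique hmin).1
  have h0 : s • e = 0 := by simpa using this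
  rcases smul_eq_zero.1 h0 with h0 | h0
  · exact hspos.ne' h0
  · rw [h0, norm_zero] at he; exact zero_ne_one he

end MinimumCircle

/-! ### Distance to the convex hull and supporting directions. -/

section Hull

variable {ι : Type*}

theorem le_infDist_convexHull [Nonempty ι] (x : ι → Plane) {e y : Plane} {δ : ℝ} (he : ‖e‖ ≤ 1)
    (h : ∀ i, δ ≤ ⟪e, x i - y⟫) : δ ≤ Metric.infDist y (convexHull ℝ (Set.range x)) := by
  have hne : (convexHull ℝ (Set.range x)).Nonempty := (Set.range_nonempty x).convexHull
  have hsub : convexHull ℝ (Set.range x) ⊆ {w | δ + ⟪e, y⟫ ≤ ⟪e, w⟫} := by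
    refine convexHull_min ?_ (convex_halfSpace_ge (innerSL ℝ e).toLinearMap.isLinear _)
    rintro _ ⟨i, rfl⟩
    have := h i
    rw [inner_sub_right] at this
    change δ + ⟪e, y⟫ ≤ ⟪e, x i⟫
    linarith
  refine (Metric.le_infDist hne).2 fun w hw => ?_
  have h1 : δ + ⟪e, y⟫ ≤ ⟪e, w⟫ := hsub hw
  have h2 := real_inner_le_norm e (w - y)
  rw [inner_sub_right] at h2
  rw [dist_comm, dist_eq_norm]
  nlinarith [norm_nonneg (w - y)]

theorem infDist_convexHull_le_dist (x : ι → Plane) (y : Plane) (i : ι) :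
    Metric.infDist y (convexHull ℝ (Set.range x)) ≤ dist (x i) y := by
  rw [dist_comm]
  exact Metric.infDist_le_dist_of_mem (subset_convexHull ℝ _ ⟨i, rfl⟩)

/-- `e` points from `y` to its nearest point in the hull; the variational inequality of the
projection gives the bound. -/
theorem exists_supporting_direction [Finite ι] [Nonempty ι] (x : ι → Plane) {y : Plane}
    (h : 0 < Metric.infDist y (convexHull ℝ (Set.range x))) :
    ∃ e : Plane, ‖e‖ = 1 ∧
      ∀ i, Metric.infDist y (convexHull ℝ (Set.range x)) ≤ ⟪e, x i - y⟫ := by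
  set K := convexHull ℝ (Set.range x) with hK
  have hne : K.Nonempty := (Set.range_nonempty x).convexHull
  have hcomp : IsCompact K := (Set.finite_range x).isCompact_convexHull ℝ
  obtain ⟨p, hp, hpd⟩ := hcomp.exists_infDist_eq_dist hne y
  have hproj : ∀ w ∈ K, ⟪y - p, w - p⟫ ≤ 0 := by
    refine (norm_eq_iInf_iff_real_inner_le_zero (convex_convexHull ℝ _) hp).1 ?_
    rw [← dist_eq_norm, ← hpd, Metric.infDist_eq_iInf]
    simp only [dist_eq_norm]
    rfl
  have hpos : 0 < dist p y := by rw [dist_comm, ← hpd]; exact h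
  refine ⟨bearing y p, norm_bearing (dist_pos.1 hpos).symm, fun i => ?_⟩
  have h1 := hproj (x i) (subset_convexHull ℝ _ ⟨i, rfl⟩)
  rw [hpd, dist_comm, bearing, ← dist_eq_norm, inner_smul_left]
  simp only [conj_trivial]
  rw [le_inv_mul_iff₀ hpos]
  have e1 : x i - y = (x i - p) + (p - y) := by abel
  have e2 : ⟪p - y, x i - p⟫ = -⟪y - p, x i - p⟫ := by
    rw [← inner_neg_left]; congr 1; abel
  rw [e1, inner_add_right, real_inner_self_eq_norm_sq, e2, ← dist_eq_norm]
  nlinarith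

end Hull

/-! ### Circling around a convergent center with a convergent radius. -/

section Circling

/-- The velocity prescribed for an agent at `y` when the circle to go around has center `c` and
radius `r`. -/
def circlingVelocity (k α rs d : ℝ) (y c : Plane) (r : ℝ) : Plane :=
  (k * (dist c y - (r + d))) • bearing y c +
    (α * step (dist c y - r - rs)) • rotCW (bearing y c)

theorem protocol_eq {n : ℕ} [NeZero n] (k α rs d : ℝ) (y : Plane) (xh : Fin n → Plane) :
    protocol k α rs d y xh = circlingVelocity k α rs d y (minCenter xh) (minRadius xh) :=
  rfl

theorem step_nonneg (s : ℝ) : 0 ≤ step s := by unfold step; split_ifs <;> norm_num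

theorem step_le_one (s : ℝ) : step s ≤ 1 := by unfold step; split_ifs <;> norm_num

/-- Adding `k • y` removes the only part of the velocity that grows with `y`. -/
theorem circlingVelocity_add_smul (k α rs d : ℝ) (y c : Plane) (r : ℝ) :
    circlingVelocity k α rs d y c r + k • y =
      k • c - (k * (r + d)) • bearing y c +
        (α * step (dist c y - r - rs)) • rotCW (bearing y c) := by
  have h : (k * dist c y) • bearing y c = k • (c - y) := by
    rw [mul_smul, dist_smul_bearing]
  rw [circlingVelocity, mul_sub, sub_smul, h]
  module

theorem norm_circlingVelocity_add_smul_le {k α rs d r : ℝ} {y c : Plane} (hk : 0 ≤ k)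
    (hα : 0 ≤ α) (hrd : 0 ≤ r + d) :
    ‖circlingVelocity k α rs d y c r + k • y‖ ≤ k * ‖c‖ + k * (r + d) + α := by
  rw [circlingVelocity_add_smul]
  refine (norm_add_le _ _).trans (add_le_add ((norm_sub_le _ _).trans (add_le_add ?_ ?_)) ?_)
  · rw [norm_smul, Real.norm_eq_abs, abs_of_nonneg hk]
  · rw [norm_smul, Real.norm_eq_abs, abs_of_nonneg (by positivity)]
    exact mul_le_of_le_one_right (by positivity) (norm_bearing_le _ _)
  · rw [norm_smul, norm_rotCW, Real.norm_eq_abs,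
      abs_of_nonneg (mul_nonneg hα (step_nonneg _))]
    calc α * step (dist c y - r - rs) * ‖bearing y c‖ ≤ α * step (dist c y - r - rs) :=
          mul_le_of_le_one_right (mul_nonneg hα (step_nonneg _)) (norm_bearing_le _ _)
      _ ≤ α := mul_le_of_le_one_right hα (step_le_one _)

theorem inner_bearing_circlingVelocity {k α rs d r : ℝ} {y c : Plane} (h : y ≠ c) :
    ⟪bearing y c, circlingVelocity k α rs d y c r⟫ = k * (dist c y - (r + d)) := by
  rw [circlingVelocity, inner_add_right, inner_smul_right, inner_smul_right, inner_self_rotCW,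
    real_inner_self_eq_norm_sq, norm_bearing h]
  ring

variable {k α rs d δ B r₀ : ℝ} {y c : ℝ → Plane} {r : ℝ → ℝ} {c₀ : Plane}

theorem norm_le_of_circling (hk : 0 < k) (hα : 0 < α) (hd : 0 < d) (hy : LocAC y)
    (hV : ∀ᵐ t : ℝ, 0 < t → HasDerivAt y (circlingVelocity k α rs d (y t) (c t) (r t)) t)
    {C R : ℝ} (hc : ∀ t, 0 ≤ t → ‖c t‖ ≤ C) (hr : ∀ t, 0 ≤ t → r t ≤ R)
    (hr0 : ∀ t, 0 ≤ t → 0 ≤ r t) :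
    ∃ B, ∀ t, 0 ≤ t → ‖y t‖ ≤ B := by
  set M := k * C + k * (R + d) + α with hM
  have hW : ∀ t, 0 ≤ t → ‖circlingVelocity k α rs d (y t) (c t) (r t) + k • y t‖ ≤ M := by
    intro t ht
    refine (norm_circlingVelocity_add_smul_le hk.le hα.le (by linarith [hr0 t ht])).trans ?_
    have := mul_le_mul_of_nonneg_left (hc t ht) hk.le
    have := mul_le_mul_of_nonneg_left (hr t ht) hk.le
    linarith
  -- The remainder is bounded by `M`, so `⟪y, y'⟫ ≤ ‖y‖ * (M - k * ‖y‖)`, and the norm cannot grow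
  -- beyond `M / k`.
  set N := max ‖y 0‖ (M / k) with hN
  have hN0 : 0 ≤ N := (norm_nonneg _).trans (le_max_left _ _)
  refine ⟨N, fun t ht => ?_⟩
  have hnorm : LocAC fun t => ‖y t‖ := hy.of_dist_le 1 fun s _ t _ => by
    rw [one_mul]; exact dist_norm_norm_le _ _
  have hf : LocAC fun t => -(‖y t‖ * ‖y t‖) := (hnorm.mul hnorm).neg
  have key : -(N * N) ≤ -(‖y t‖ * ‖y t‖) := by
    refine barrier (T := t) hf ?_ ?_ ht le_rfl
    · have := mul_self_le_mul_self (norm_nonneg _) (le_max_left ‖y 0‖ (M / k))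
      linarith
    · filter_upwards [hV] with s hs h0 _ hlt
      have hNs : N ≤ ‖y s‖ := by
        by_contra hcon
        have := mul_self_le_mul_self (norm_nonneg _) (not_le.1 hcon).le
        linarith
      have hd1 := (hs h0).norm_sq.neg
      have e : (fun t => -(‖y t‖ * ‖y t‖)) = -fun x => ‖y x‖ ^ 2 := by
        funext u; simp [sq]
      rw [e, hd1.deriv]
      have h1 := real_inner_le_norm (y s) (circlingVelocity k α rs d (y s) (c s) (r s) + k • y s)
      rw [inner_add_right, inner_smul_right, real_inner_self_eq_norm_sq] at h1
      have h2 := mul_le_mul_of_nonneg_left (hW s h0.le) (norm_nonneg (y s))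
      have h3 : M ≤ k * ‖y s‖ := by
        have := (le_max_right ‖y 0‖ (M / k)).trans hNs
        rw [div_le_iff₀ hk] at this
        linarith
      have h4 := mul_le_mul_of_nonneg_left h3 (norm_nonneg (y s))
      nlinarith
  exact abs_le_of_sq_le_sq' (by nlinarith) hN0 |>.2

theorem tendsto_bearing_sub (hδ : 0 < δ) (hc : Tendsto c atTop (𝓝 c₀))
    (hlow : ∀ t, 0 ≤ t → δ ≤ dist (c t) (y t)) :
    Tendsto (fun t => bearing (y t) (c t) - bearing (y t) c₀) atTop (𝓝 0) := by
  rw [tendsto_zero_iff_norm_tendsto_zero]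
  have h1 : Tendsto (fun t => 2 * δ⁻¹ * ‖c t - c₀‖) atTop (𝓝 0) := by
    simpa using (tendsto_iff_norm_sub_tendsto_zero.1 hc).const_mul (2 * δ⁻¹)
  refine squeeze_zero' (Eventually.of_forall fun _ => norm_nonneg _) ?_ h1
  filter_upwards [eventually_ge_atTop 0] with t ht
  have hpos := hδ.trans_le (hlow t ht)
  refine (dist_bearing_le (dist_pos.1 hpos).symm).trans ?_
  rw [sub_sub_sub_cancel_right]
  have := inv_anti₀ hδ (hlow t ht)
  gcongr

theorem tendsto_dist_sub (hc : Tendsto c atTop (𝓝 c₀)) :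
    Tendsto (fun t => dist (c t) (y t) - dist c₀ (y t)) atTop (𝓝 0) := by
  rw [tendsto_zero_iff_abs_tendsto_zero]
  refine squeeze_zero (fun _ => abs_nonneg _) (fun t => ?_) (tendsto_iff_dist_tendsto_zero.1 hc)
  exact abs_dist_sub_le _ _ _

theorem eventually_norm_circlingVelocity_le (hk : 0 < k) (hα : 0 < α) (hd : 0 < d)
    (hc : Tendsto c atTop (𝓝 c₀)) (hr : Tendsto r atTop (𝓝 r₀)) (hr0 : ∀ t, 0 ≤ t → 0 ≤ r t)
    (hB : ∀ t, 0 ≤ t → ‖y t‖ ≤ B) :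
    ∀ᶠ t in atTop, ‖circlingVelocity k α rs d (y t) (c t) (r t)‖ ≤
      k * (‖c₀‖ + 1) + k * (r₀ + 1 + d) + α + k * B := by
  filter_upwards [eventually_ge_atTop 0, hc.norm.eventually_lt_const (lt_add_one _),
    hr.eventually_lt_const (lt_add_one _)] with t ht h1 h2
  have h3 := norm_circlingVelocity_add_smul_le (rs := rs) (y := y t) (c := c t) hk.le hα.le
    (show 0 ≤ r t + d by linarith [hr0 t ht])
  have h4 := norm_sub_le (circlingVelocity k α rs d (y t) (c t) (r t) + k • y t) (k • y t)
  rw [add_sub_cancel_right, norm_smul, Real.norm_eq_abs, abs_of_pos hk] at h4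
  have := mul_le_mul_of_nonneg_left h1.le hk.le
  have := mul_le_mul_of_nonneg_left h2.le hk.le
  have := mul_le_mul_of_nonneg_left (hB t ht) hk.le
  linarith

/-- The agent approaches the limit circle at the prescribed distance. -/
theorem tendsto_dist_of_circling (hk : 0 < k) (hα : 0 < α) (hd : 0 < d) (hδ : 0 < δ)
    (hy : LocAC y)
    (hV : ∀ᵐ t : ℝ, 0 < t → HasDerivAt y (circlingVelocity k α rs d (y t) (c t) (r t)) t)
    (hc : Tendsto c atTop (𝓝 c₀)) (hr : Tendsto r atTop (𝓝 r₀)) (hr0 : ∀ t, 0 ≤ t → 0 ≤ r t)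
    (hB : ∀ t, 0 ≤ t → ‖y t‖ ≤ B) (hlow : ∀ t, 0 ≤ t → δ ≤ dist (c t) (y t)) :
    Tendsto (fun t => dist c₀ (y t)) atTop (𝓝 (r₀ + d)) := by
  obtain ⟨T, hT⟩ := eventually_atTop.1
    ((hc.dist tendsto_const_nhds : Tendsto (fun t => dist (c t) c₀) atTop (𝓝 (dist c₀ c₀))
      ).eventually_lt_const (by rw [dist_self]; exact hδ) |>.and (eventually_ge_atTop 0))
  have hT0 : 0 ≤ T := (hT T le_rfl).2
  have hne : ∀ t, T ≤ t → y t ≠ c₀ := by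
    rintro t ht rfl
    exact absurd ((hT t ht).1) (not_lt.2 (hlow t (hT0.trans ht)))
  have hLip : LocAC fun t => dist c₀ (y t) - (r₀ + d) := hy.of_dist_le 1 fun s _ t _ => by
    rw [Real.dist_eq, one_mul]
    have := abs_dist_sub_le (y s) (y t) c₀
    rw [dist_comm c₀, dist_comm c₀]
    convert this using 2; ring
  set V : ℝ → Plane := fun t => circlingVelocity k α rs d (y t) (c t) (r t) with hVdef
  -- The radial equation is exact for the moving center; replacing it by `c₀` costs a bearing
  -- difference times a bounded velocity, which vanishes.
  have hlim : Tendsto (fun t => -⟪bearing (y t) c₀, V t⟫ + k * (dist c₀ (y t) - (r₀ + d))) atTop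
      (𝓝 0) := by
    have h1 : Tendsto (fun t => ⟪bearing (y t) (c t) - bearing (y t) c₀, V t⟫) atTop (𝓝 0) := by
      have hb := eventually_norm_circlingVelocity_le (rs := rs) hk hα hd hc hr hr0 hB
      set M := k * (‖c₀‖ + 1) + k * (r₀ + 1 + d) + α + k * B
      rw [tendsto_zero_iff_abs_tendsto_zero]
      have h2 := (tendsto_zero_iff_norm_tendsto_zero.1 (tendsto_bearing_sub hδ hc hlow)).mul_const M
      rw [zero_mul] at h2
      refine squeeze_zero' (Eventually.of_forall fun _ => abs_nonneg _) ?_ h2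
      filter_upwards [hb] with t ht
      exact (abs_real_inner_le_norm _ _).trans (mul_le_mul_of_nonneg_left ht (norm_nonneg _))
    have h3 : Tendsto (fun t => -(k * (dist (c t) (y t) - dist c₀ (y t))) + k * (r t - r₀)) atTop
        (𝓝 0) := by
      have := ((tendsto_dist_sub (y := y) hc).const_mul k).neg.add
        ((hr.sub_const r₀).const_mul k)
      simpa using this
    have h4 := h1.add h3
    rw [add_zero] at h4
    refine h4.congr' ?_
    filter_upwards [eventually_ge_atTop 0] with t ht
    have hne : y t ≠ c t := (dist_pos.1 (hδ.trans_le (hlow t ht))).symm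
    rw [inner_sub_left, hVdef]
    simp only
    rw [inner_bearing_circlingVelocity hne]
    ring
  have h5 : Tendsto (fun t => dist c₀ (y t) - (r₀ + d)) atTop (𝓝 0) := by
    refine tendsto_zero_of_deriv_add_mul_tendsto (T₀ := T) hk hLip ?_ hlim
    filter_upwards [hV] with t ht h0
    exact (hasDerivAt_dist (ht (hT0.trans_lt h0)) (hne t h0.le)).sub_const (r₀ + d)
  simpa using h5.add_const (r₀ + d)

theorem hasDerivAt_of_inner {v : Plane} {t : ℝ}
    (h : ∀ w : Plane, HasDerivAt (fun s => ⟪w, y s⟫) ⟪w, v⟫ t) : HasDerivAt y v t := by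
  have e : ∀ u : Plane, u = ⟪!₂[1, 0], u⟫ • !₂[1, 0] + ⟪!₂[0, 1], u⟫ • !₂[0, 1] := by
    intro u
    ext i; fin_cases i <;> simp [inner_eq_coord]
  have h1 := ((h !₂[1, 0]).smul_const (!₂[1, 0] : Plane)).add
    ((h !₂[0, 1]).smul_const (!₂[0, 1] : Plane))
  rw [← e v] at h1
  exact h1.congr_of_eventuallyEq (Eventually.of_forall fun s => e (y s))

/-- Once the tangential control is switched on for good, the agent moves differentiably. -/
theorem eventually_hasDerivAt_of_circling (hδ : 0 < δ) (hd : rs < d) (hy : LocAC y)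
    (hV : ∀ᵐ t : ℝ, 0 < t → HasDerivAt y (circlingVelocity k α rs d (y t) (c t) (r t)) t)
    (hcc : ContinuousOn c (Set.Ici 0)) (hrc : ContinuousOn r (Set.Ici 0))
    (hlow : ∀ t, 0 ≤ t → δ ≤ dist (c t) (y t))
    (hq : Tendsto (fun t => dist (c t) (y t) - r t) atTop (𝓝 d)) :
    ∀ᶠ t in atTop, HasDerivAt y (circlingVelocity k α rs d (y t) (c t) (r t)) t := by
  -- Since `rs < d`, the argument of `step` is positive from `T` on, so the velocity is continuous
  -- there.
  obtain ⟨T, hT⟩ := eventually_atTop.1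
    ((hq.eventually_const_lt hd).and (eventually_ge_atTop 0))
  have hT0 : 0 ≤ T := (hT T le_rfl).2
  have hsub : Set.Ioi T ⊆ Set.Ici 0 := fun t ht => hT0.trans (le_of_lt ht)
  have hyc : ContinuousOn y (Set.Ioi T) := hy.continuousOn.mono hsub
  have hbc : ContinuousOn (fun t => bearing (y t) (c t)) (Set.Ioi T) := by
    intro t ht
    have hne : y t ≠ c t := (dist_pos.1 (hδ.trans_le (hlow t (hsub ht)))).symm
    exact (continuousAt_bearing hne).comp_continuousWithinAt (f := fun t => (y t, c t))
      ((hyc t ht).prodMk ((hcc.mono hsub) t ht))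
  have hF : ContinuousOn (fun t => circlingVelocity k α rs d (y t) (c t) (r t)) (Set.Ioi T) := by
    have h1 : ContinuousOn (fun t => (k * (dist (c t) (y t) - (r t + d))) • bearing (y t) (c t) +
        α • rotCW (bearing (y t) (c t))) (Set.Ioi T) := by
      have h2 : ContinuousOn c (Set.Ioi T) := hcc.mono hsub
      have h3 : ContinuousOn r (Set.Ioi T) := hrc.mono hsub
      have h4 : ContinuousOn (fun t => rotCW (bearing (y t) (c t))) (Set.Ioi T) :=
        continuous_rotCW.comp_continuousOn hbc
      have h5 : ContinuousOn (fun t => k * (dist (c t) (y t) - (r t + d))) (Set.Ioi T) :=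
        by fun_prop
      exact (h5.smul hbc).add (h4.const_smul α)
    refine h1.congr fun t ht => ?_
    have : step (dist (c t) (y t) - r t - rs) = 1 :=
      if_pos (by linarith [(hT t (le_of_lt ht)).1])
    rw [circlingVelocity, this, mul_one]
  filter_upwards [eventually_gt_atTop T] with t ht
  refine hasDerivAt_of_inner fun w => ?_
  refine hasDerivAt_of_ae_hasDerivAt
    (F := fun t => ⟪w, circlingVelocity k α rs d (y t) (c t) (r t)⟫) hT0 (hy.inner_const w) ?_ ?_ ht
  · filter_upwards [hV] with s hs hTs
    exact (innerSL ℝ w).hasFDerivAt.comp_hasDerivAt s (hs (hT0.trans_lt hTs))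
  · exact continuousOn_const.inner hF

/-- The radial gain vanishes in the limit, and the tangential term stays on because `rs < d`. -/
theorem tendsto_circlingVelocity_sub (hd : rs < d) (hδ : 0 < δ)
    (hc : Tendsto c atTop (𝓝 c₀)) (hlow : ∀ t, 0 ≤ t → δ ≤ dist (c t) (y t))
    (hq : Tendsto (fun t => dist (c t) (y t) - r t) atTop (𝓝 d)) :
    Tendsto (fun t => circlingVelocity k α rs d (y t) (c t) (r t) -
      α • rotCW (bearing (y t) c₀)) atTop (𝓝 0) := by
  have h1 : Tendsto (fun t => (k * (dist (c t) (y t) - (r t + d))) • bearing (y t) (c t)) atTop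
      (𝓝 0) := by
    rw [tendsto_zero_iff_norm_tendsto_zero]
    have h2 : Tendsto (fun t => |k * (dist (c t) (y t) - (r t + d))|) atTop (𝓝 0) := by
      refine (tendsto_zero_iff_abs_tendsto_zero _).1 ?_
      have := (hq.sub_const d).const_mul k
      rw [sub_self, mul_zero] at this
      exact this.congr fun t => by ring
    refine squeeze_zero (fun _ => norm_nonneg _) (fun t => ?_) h2
    rw [norm_smul, Real.norm_eq_abs]
    exact mul_le_of_le_one_right (abs_nonneg _) (norm_bearing_le _ _)
  have h3 : Tendsto (fun t => α • rotCW (bearing (y t) (c t) - bearing (y t) c₀)) atTop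
      (𝓝 0) := by
    have h4 := (continuous_rotCW.tendsto 0).comp (tendsto_bearing_sub hδ hc hlow)
    have h5 := h4.const_smul α
    have h6 : rotCW 0 = 0 := by rw [← norm_eq_zero, norm_rotCW, norm_zero]
    rw [h6, smul_zero] at h5
    exact h5
  have h7 := h1.add h3
  rw [add_zero] at h7
  refine h7.congr' ?_
  filter_upwards [hq.eventually_const_lt hd] with t ht
  have : step (dist (c t) (y t) - r t - rs) = 1 := if_pos (by linarith)
  rw [circlingVelocity, this, mul_one, rotCW_sub, smul_sub]
  abel

/-- A point that circles around `c₀` forever has no convergent coordinate. -/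
theorem not_tendsto_inner_of_circling {V : ℝ → Plane} {R G : ℝ} {w : Plane} (hα : 0 < α)
    (hR : 0 < R) (hy : LocAC y) (hV : ∀ᵐ t : ℝ, 0 < t → HasDerivAt y (V t) t)
    (hB : ∀ t, 0 ≤ t → ‖y t‖ ≤ B) (hdist : Tendsto (fun t => dist c₀ (y t)) atTop (𝓝 R))
    (hlim : Tendsto (fun t => V t - α • rotCW (bearing (y t) c₀)) atTop (𝓝 0))
    (hw : ‖w‖ = 1) : ¬ Tendsto (fun t => ⟪w, y t - c₀⟫) atTop (𝓝 G) := by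
  intro hG
  set ω := α / R with hω
  have hωpos : 0 < ω := div_pos hα hR
  set g : ℝ → ℝ := fun t => ⟪w, y t - c₀⟫ with hg
  -- `g'` is the orthogonal coordinate, not the derivative of `g`. Asymptotically `y - c₀` rotates
  -- at speed `ω`: the derivative of `g` is close to `ω * g'`, that of `g'` to `-ω * g`.
  set g' : ℝ → ℝ := fun t => ⟪rotCW w, y t - c₀⟫ with hg'
  have hzb : ∀ t, 0 ≤ t → ‖y t - c₀‖ ≤ B + ‖c₀‖ := fun t ht =>
    (norm_sub_le _ _).trans (by linarith [hB t ht])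
  have hz : LocAC fun t => y t - c₀ := hy.of_dist_le 1 fun s _ t _ => by simp
  have hgb : ∀ t, 0 ≤ t → |g t| ≤ B + ‖c₀‖ := fun t ht =>
    (abs_real_inner_le_norm _ _).trans (by rw [hw, one_mul]; exact hzb t ht)
  have hg'b : ∀ t, 0 ≤ t → |g' t| ≤ B + ‖c₀‖ := fun t ht =>
    (abs_real_inner_le_norm _ _).trans (by rw [norm_rotCW, hw, one_mul]; exact hzb t ht)
  have hdg : ∀ v : Plane, ∀ᵐ t : ℝ, 0 < t →
      HasDerivAt (fun s => ⟪v, y s - c₀⟫) ⟪v, V t⟫ t := fun v => by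
    filter_upwards [hV] with t ht h0
    exact ((innerSL ℝ v).hasFDerivAt.comp_hasDerivAt t ((ht h0).sub_const c₀))
  have hlim2 : Tendsto (fun t => V t + ω • rotCW (y t - c₀)) atTop (𝓝 0) := by
    have h1 : Tendsto (fun t => ((α / R - α / dist c₀ (y t)) * dist c₀ (y t))) atTop (𝓝 0) := by
      have := (((tendsto_const_nhds (x := α)).div hdist hR.ne').const_sub (α / R)).mul hdist
      simpa using this
    have h2 : Tendsto (fun t => ((α / R - α / dist c₀ (y t)) * dist c₀ (y t)) •
        rotCW (bearing (y t) c₀)) atTop (𝓝 0) := by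
      rw [tendsto_zero_iff_norm_tendsto_zero]
      refine squeeze_zero (fun _ => norm_nonneg _) (fun t => ?_)
        (tendsto_zero_iff_abs_tendsto_zero _ |>.1 h1)
      rw [norm_smul, Real.norm_eq_abs, norm_rotCW]
      exact mul_le_of_le_one_right (abs_nonneg _) (norm_bearing_le _ _)
    have h3 := hlim.sub h2
    rw [sub_zero] at h3
    refine h3.congr' ?_
    filter_upwards [hdist.eventually_const_lt hR] with t ht
    have e1 : y t - c₀ = -(dist c₀ (y t)) • bearing (y t) c₀ := by
      rw [neg_smul, dist_smul_bearing]; abel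
    rw [e1, rotCW_smul, smul_smul]
    have e2 : (α / R - α / dist c₀ (y t)) * dist c₀ (y t) = ω * dist c₀ (y t) - α := by
      rw [hω]; field_simp
    rw [e2]
    module
  have hv : ∀ v : Plane, Tendsto (fun t => ⟪v, V t⟫ + ω * ⟪v, rotCW (y t - c₀)⟫) atTop
      (𝓝 0) := fun v => by
    have h1 := (tendsto_const_nhds (x := v)).inner (𝕜 := ℝ) hlim2
    rw [inner_zero_right] at h1
    refine h1.congr fun t => ?_
    rw [inner_add_right, inner_smul_right]
  have hF' : Tendsto (fun t => ⟪rotCW w, V t⟫) atTop (𝓝 (-(ω * G))) := by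
    have h1 := (hv (rotCW w)).sub (hG.const_mul ω)
    rw [zero_sub] at h1
    refine h1.congr fun t => ?_
    rw [inner_rotCW_rotCW]
    ring
  -- The derivative of the bounded `g'` tends to `-ω * G`, which must be zero.
  have hG0 : G = 0 := by
    have := deriv_limit_eq_zero (hz.inner_const (rotCW w)) (hdg (rotCW w)) hF' hg'b
    have h2 : ω * G = 0 := by linarith
    exact (mul_eq_zero.1 h2).resolve_left hωpos.ne'
  rw [hG0] at hG hF'
  have hsq : Tendsto (fun t => g' t ^ 2) atTop (𝓝 (R ^ 2)) := by
    have h1 := (hdist.pow 2).sub (hG.pow 2)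
    rw [zero_pow two_ne_zero, sub_zero] at h1
    refine h1.congr fun t => ?_
    have := inner_sq_add_inner_rotCW_sq w (y t - c₀)
    rw [hw, one_pow, one_mul, ← dist_eq_norm, dist_comm] at this
    linarith
  -- With `g → 0` and `g' ^ 2 → R ^ 2`, the bounded product `g * g'` would have a derivative tending
  -- to `ω * R ^ 2 > 0`.
  have hprod : Tendsto (fun t => ⟪w, V t⟫ * g' t + g t * ⟪rotCW w, V t⟫) atTop
      (𝓝 (ω * R ^ 2)) := by
    have h1 : Tendsto (fun t => (⟪w, V t⟫ + ω * ⟪w, rotCW (y t - c₀)⟫) * g' t) atTop (𝓝 0) := by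
      refine (hv w).zero_mul_isBoundedUnder_le ⟨B + ‖c₀‖, ?_⟩
      rw [eventually_map]
      filter_upwards [eventually_ge_atTop 0] with t ht
      exact hg'b t ht
    have h2 := (h1.add (hsq.const_mul ω)).add (hG.mul hF')
    rw [zero_mul, add_zero, zero_add] at h2
    refine h2.congr fun t => ?_
    have : ⟪w, rotCW (y t - c₀)⟫ = -g' t := by rw [hg']; simp only; rw [inner_rotCW_left, neg_neg]
    rw [this]
    ring
  have hpos : ω * R ^ 2 = 0 := by
    refine deriv_limit_eq_zero (B := (B + ‖c₀‖) * (B + ‖c₀‖))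
      ((hz.inner_const w).mul (hz.inner_const (rotCW w))) ?_ hprod fun t ht => ?_
    · filter_upwards [hdg w, hdg (rotCW w)] with t h1 h2 h0
      exact (h1 h0).mul (h2 h0)
    · rw [abs_mul]
      exact mul_le_mul (hgb t ht) (hg'b t ht) (abs_nonneg _)
        ((abs_nonneg _).trans (hgb t ht))
  exact (by positivity : ω * R ^ 2 ≠ 0) hpos

end Circling

/-! ### Geometry of underestimated targets. -/

section Estimate

variable {n : ℕ} (x : Fin n → Plane) (y : Plane) (ρ : Fin n → ℝ)

theorem estimate_sub_agent {i : Fin n} (h : y ≠ x i) :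
    estimate x y ρ i - y = (ρ i / dist (x i) y) • (x i - y) := by
  have : dist (x i) y ≠ 0 := dist_ne_zero.2 h.symm
  rw [estimate, add_sub_cancel_left, ← dist_smul_bearing y (x i), smul_smul,
    div_mul_cancel₀ _ this]

theorem estimate_eq (i : Fin n) :
    estimate x y ρ i = x i + (ρ i - dist (x i) y) • bearing y (x i) := by
  rw [estimate, sub_smul, dist_smul_bearing]
  abel

variable {x y ρ}

/-- If the distances are underestimated, the agent is not closer to the hull of the targets than
to the minimum circle of the estimated targets. -/
theorem dist_minCenter_estimate_le [NeZero n] (hρ : ∀ i, 0 < ρ i ∧ ρ i ≤ dist (x i) y) :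
    dist (minCenter (estimate x y ρ)) y - minRadius (estimate x y ρ) ≤
      Metric.infDist y (convexHull ℝ (Set.range x)) := by
  set c := minCenter (estimate x y ρ) with hc
  set r := minRadius (estimate x y ρ) with hr
  rcases le_or_gt (dist c y - r) 0 with h | h
  · exact h.trans Metric.infDist_nonneg
  have hcy : 0 < dist c y := by
    have : 0 ≤ r := minRadius_nonneg _
    linarith
  have hne : y ≠ c := (dist_pos.1 hcy).symm
  refine le_infDist_convexHull x (norm_bearing_le y c) fun i => ?_
  have hi := hρ i
  have hpos : 0 < dist (x i) y := hi.1.trans_le hi.2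
  -- The estimated disc lies beyond a line orthogonal to the bearing of `c`. The true targets are
  -- the estimates stretched away from `y` by factors at least 1, so they lie beyond it too.
  have h1 : dist c y - r ≤ ⟪bearing y c, estimate x y ρ i - y⟫ := by
    have e : estimate x y ρ i - y = (c - y) - (c - estimate x y ρ i) := by abel
    rw [e, inner_sub_right]
    have e2 : ⟪bearing y c, c - y⟫ = dist c y := by
      rw [← dist_smul_bearing y c, inner_smul_right, real_inner_self_eq_norm_sq, norm_bearing hne]
      ring
    have e3 : ⟪bearing y c, c - estimate x y ρ i⟫ ≤ r := by
      refine (real_inner_le_norm _ _).trans ?_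
      rw [norm_bearing hne, one_mul, ← dist_eq_norm, dist_comm]
      exact dist_minCenter_le _ i
    linarith
  rw [estimate_sub_agent x y ρ (dist_pos.1 hpos).symm, inner_smul_right] at h1
  have h2 : ρ i / dist (x i) y ≤ 1 := (div_le_one hpos).2 hi.2
  have h3 : 0 < ρ i / dist (x i) y := div_pos hi.1 hpos
  have h4 : 0 < ⟪bearing y c, x i - y⟫ := by
    by_contra hcon
    have := mul_nonpos_of_nonneg_of_nonpos h3.le (not_lt.1 hcon)
    linarith
  nlinarith

/-- The center of the minimum circle of the estimated targets lies well ahead of the agent in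
the direction of the targets. -/
theorem le_inner_minCenter_estimate [NeZero n] {e : Plane} {h P D : ℝ} (he : ‖e‖ = 1)
    (hh : 0 < h) (hD : 0 < D) (hx : ∀ i, D ≤ ⟪e, x i - y⟫) (hρ : ∀ i, h ≤ ρ i)
    (hP : ∀ i, dist (x i) y ≤ P) :
    h / P * D ≤ ⟪e, minCenter (estimate x y ρ) - y⟫ := by
  refine le_inner_minCenter _ he fun i => ?_
  have hpos : 0 < dist (x i) y := by
    have h1 := hD.trans_le (hx i)
    rcases eq_or_ne (x i) y with hxy | hxy
    · rw [hxy, sub_self, inner_zero_right] at h1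
      exact absurd h1 (lt_irrefl _)
    · exact dist_pos.2 hxy
  rw [estimate_sub_agent x y ρ (dist_pos.1 hpos).symm, inner_smul_right]
  exact mul_le_mul (div_le_div₀ (hh.le.trans (hρ i)) (hρ i) hpos (hP i)) (hx i) hD.le
    (div_nonneg (hh.le.trans (hρ i)) hpos.le)

end Estimate

/-! ### Invariance of the safety distance and of the bounds on the estimates. -/

section Invariance

/-- The distance of the agent to the convex hull of the targets. -/
def hullDist {n : ℕ} (x : Fin n → Plane) (y : ℝ → Plane) (t : ℝ) : ℝ :=
  Metric.infDist (y t) (convexHull ℝ (Set.range x))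

theorem ne_of_hullDist_pos {n : ℕ} {x : Fin n → Plane} {y : ℝ → Plane} {t : ℝ}
    (h : 0 < hullDist x y t) (i : Fin n) :
    y t ≠ x i := by
  have := h.trans_le (infDist_convexHull_le_dist x (y t) i)
  exact (dist_pos.1 this).symm


variable {n : ℕ} [NeZero n] {x : Fin n → Plane} {k α rs d h : ℝ} {y : ℝ → Plane}
  {ρh : Fin n → ℝ → ℝ}

theorem IsSolution.locAC_dist (hsol : IsSolution k α rs d h x y ρh) (i : Fin n) :
    LocAC fun t => dist (x i) (y t) :=
  LocAC.of_dist_le (f := y) hsol.absCont_agent 1 fun s _ t _ => by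
    rw [one_mul, dist_comm (x i), dist_comm (x i), Real.dist_eq]
    exact abs_dist_sub_le _ _ _

theorem IsSolution.locAC_hullDist (hsol : IsSolution k α rs d h x y ρh) :
    LocAC (hullDist x y) :=
  LocAC.of_dist_le (f := y) hsol.absCont_agent 1 fun s _ t _ => by
    have := (Metric.lipschitz_infDist_pt (convexHull ℝ (Set.range x))).dist_le_mul (y s) (y t)
    simpa [hullDist] using this

/-- The velocity of the agent. -/
abbrev agentVelocity (k α rs d : ℝ) (x : Fin n → Plane) (y : ℝ → Plane) (ρh : Fin n → ℝ → ℝ)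
    (t : ℝ) : Plane :=
  protocol k α rs d (y t) (estimate x (y t) fun i => ρh i t)

/-- The angular speed of the bearing of the target `b` when the agent moves at velocity `v`. -/
def angularSpeed (y b v : Plane) : ℝ := |⟪rotCW (bearing y b), v⟫| / dist b y

theorem angularSpeed_nonneg (y b v : Plane) : 0 ≤ angularSpeed y b v :=
  div_nonneg (abs_nonneg _) dist_nonneg

theorem IsSolution.hasDerivAt_compensator (hsol : IsSolution k α rs d h x y ρh) (i : Fin n) :
    ∀ᵐ t : ℝ, 0 < t → y t ≠ x i →
      HasDerivAt (ρh i) (-⟪bearing (y t) (x i), agentVelocity k α rs d x y ρh t⟫ *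
        step (ρh i t - h) + angularSpeed (y t) (x i) (agentVelocity k α rs d x y ρh t) *
          (dist (x i) (y t) - ρh i t)) t := by
  filter_upwards [hsol.agent, hsol.compensators i] with t h1 h2 h0 hne
  have h3 := h2 h0
  rwa [compensator_eq (h1 h0) hne] at h3

/-- Below `h` the radial term is switched off, and what is left pulls the estimate up to a true
distance that is at least `h`. -/
theorem IsSolution.le_compensator (hsol : IsSolution k α rs d h x y ρh) (hh : 0 < h) {T : ℝ}
    (hD : ∀ t, 0 ≤ t → t ≤ T → h ≤ hullDist x y t) (i : Fin n) (h0 : h ≤ ρh i 0) {t : ℝ}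
    (ht : 0 ≤ t) (htT : t ≤ T) : h ≤ ρh i t := by
  refine barrier (hsol.absCont_compensator i) h0 ?_ ht htT
  filter_upwards [hsol.hasDerivAt_compensator i] with s hs hs0 hsT hlt
  have hDs := hD s hs0.le hsT.le
  rw [(hs hs0 (ne_of_hullDist_pos (hh.trans_le hDs) i)).deriv]
  have hst : step (ρh i s - h) = 0 := if_neg (by linarith)
  have := infDist_convexHull_le_dist x (y s) i
  rw [hst, mul_zero, zero_add]
  refine mul_nonneg (angularSpeed_nonneg _ _ _) ?_
  rw [hullDist] at hDs
  linarith

/-- With the step on, the radial term is exactly the derivative of the true distance and cancels. -/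
theorem IsSolution.hasDerivAt_error (hsol : IsSolution k α rs d h x y ρh) (i : Fin n) :
    ∀ᵐ t : ℝ, 0 < t → y t ≠ x i → h ≤ ρh i t →
      HasDerivAt (fun s => ρh i s - dist (x i) (y s))
        (angularSpeed (y t) (x i) (agentVelocity k α rs d x y ρh t) *
          (dist (x i) (y t) - ρh i t)) t := by
  filter_upwards [hsol.agent, hsol.hasDerivAt_compensator i] with t h1 h2 h0 hne hle
  have h3 := (h2 h0 hne).sub (hasDerivAt_dist (h1 h0) hne)
  have hst : step (ρh i t - h) = 1 := if_pos (by linarith)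
  rw [hst] at h3
  refine h3.congr_deriv ?_
  simp only [agentVelocity]
  ring

theorem IsSolution.compensator_le (hsol : IsSolution k α rs d h x y ρh) (hh : 0 < h) {T : ℝ}
    (hD : ∀ t, 0 ≤ t → t ≤ T → h ≤ hullDist x y t) (i : Fin n) (h0 : h ≤ ρh i 0)
    (h1 : ρh i 0 ≤ dist (x i) (y 0)) {t : ℝ} (ht : 0 ≤ t) (htT : t ≤ T) :
    ρh i t ≤ dist (x i) (y t) := by
  have hAC : LocAC fun s => -(ρh i s - dist (x i) (y s)) :=
    (LocAC.sub (hsol.absCont_compensator i) (hsol.locAC_dist i)).neg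
  have := barrier (K := 0) hAC (by linarith) ?_ ht htT
  · linarith
  filter_upwards [hsol.hasDerivAt_error i] with s hs hs0 hsT hlt
  have hd := (hs hs0 (ne_of_hullDist_pos (hh.trans_le (hD s hs0.le hsT.le)) i)
    (hsol.le_compensator hh hD i h0 hs0.le hsT.le)).neg
  have hd2 : deriv (fun s => -(ρh i s - dist (x i) (y s))) s = _ := hd.deriv
  rw [hd2, ← mul_neg]
  exact mul_nonneg (angularSpeed_nonneg _ _ _) (by linarith)

/-- Closer than `rs` to the hull, the tangential control is off and the radial gain is negative,
while the estimated center lies ahead in the supporting direction: the agent retreats. -/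
theorem IsSolution.le_hullDist_of_le (hsol : IsSolution k α rs d h x y ρh) (hk : 0 < k)
    (hh : 0 < h) (hd : rs < d) (h0 : rs ≤ hullDist x y 0)
    (hρ : ∀ i, h ≤ ρh i 0 ∧ ρh i 0 ≤ dist (x i) (y 0)) {T : ℝ}
    (hD : ∀ t, 0 ≤ t → t ≤ T → h ≤ hullDist x y t) {t : ℝ} (ht : 0 ≤ t) (htT : t ≤ T) :
    rs ≤ hullDist x y t := by
  refine barrier hsol.locAC_hullDist h0 ?_ ht htT
  filter_upwards [hsol.agent, hsol.locAC_hullDist.ae_differentiableAt] with s hs hdiff hs0 hsT hlt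
  have hDs : 0 < hullDist x y s := hh.trans_le (hD s hs0.le hsT.le)
  have hle := fun i => hsol.le_compensator hh hD i (hρ i).1 hs0.le hsT.le
  have hge := fun i => hsol.compensator_le hh hD i (hρ i).1 (hρ i).2 hs0.le hsT.le
  obtain ⟨e, he, hsup⟩ := exists_supporting_direction x hDs
  obtain ⟨P, hP⟩ := (Set.finite_range fun i => dist (x i) (y s)).bddAbove
  have hP' : ∀ i, dist (x i) (y s) ≤ P := fun i => hP ⟨i, rfl⟩
  have hP0 : 0 ≤ P := dist_nonneg.trans (hP' 0)
  have hahead := le_inner_minCenter_estimate he hh hDs hsup hle hP'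
  have hq := dist_minCenter_estimate_le (x := x) (y := y s) (ρ := fun i => ρh i s)
    fun i => ⟨hh.trans_le (hle i), hge i⟩
  set c := minCenter (estimate x (y s) fun i => ρh i s)
  set r := minRadius (estimate x (y s) fun i => ρh i s)
  change dist c (y s) - r ≤ hullDist x y s at hq
  set v := protocol k α rs d (y s) (estimate x (y s) fun i => ρh i s) with hv
  have hv' : v = (k * (dist c (y s) - (r + d))) • bearing (y s) c := by
    have hst : step (dist c (y s) - r - rs) = 0 := if_neg (by linarith)
    rw [hv, protocol_eq, circlingVelocity, hst, mul_zero, zero_smul, add_zero]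
  -- Envelope argument: with `e` frozen at time `s`, the supporting half-plane bounds the hull
  -- distance from below with equality at `s`, so its derivative is `-⟪e, v⟫`.
  have hmin : IsLocalMin (fun u => hullDist x y u + ⟪e, y u⟫) s := by
    refine Eventually.of_forall fun u => ?_
    have h1 : hullDist x y s + ⟪e, y s⟫ - ⟪e, y u⟫ ≤ hullDist x y u := by
      refine le_infDist_convexHull x he.le fun i => ?_
      have := hsup i
      rw [inner_sub_right] at this ⊢
      change hullDist x y s ≤ _ at this
      linarith
    change hullDist x y s + ⟪e, y s⟫ ≤ hullDist x y u + ⟪e, y u⟫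
    linarith
  have hder : HasDerivAt (fun u => hullDist x y u + ⟪e, y u⟫)
      (deriv (hullDist x y) s + ⟪e, v⟫) s :=
    (hdiff hs0).hasDerivAt.add ((innerSL ℝ e).hasFDerivAt.comp_hasDerivAt s (hs hs0))
  have h2 := hmin.hasDerivAt_eq_zero hder
  have h3 : ⟪e, v⟫ ≤ 0 := by
    rw [hv', inner_smul_right, bearing, inner_smul_right]
    refine mul_nonpos_of_nonpos_of_nonneg
      (mul_nonpos_of_nonneg_of_nonpos hk.le (by linarith)) ?_
    refine mul_nonneg (inv_nonneg.2 (norm_nonneg _)) (le_trans ?_ hahead)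
    exact mul_nonneg (div_nonneg hh.le hP0) hDs.le
  linarith

/-- Bootstrap: up to the first time `τ` at which the hull distance falls to `h`, the weak bound `h`
already yields the stronger bound `rs`, so `τ` cannot exist. -/
theorem IsSolution.le_hullDist (hsol : IsSolution k α rs d h x y ρh) (hk : 0 < k)
    (hh : 0 < h) (hrs : h < rs) (hd : rs < d) (h0 : rs ≤ hullDist x y 0)
    (hρ : ∀ i, h ≤ ρh i 0 ∧ ρh i 0 ≤ dist (x i) (y 0)) {t : ℝ} (ht : 0 ≤ t) :
    rs ≤ hullDist x y t := by
  refine hsol.le_hullDist_of_le hk hh hd h0 hρ (T := t) (fun s hs _ => ?_) ht le_rfl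
  by_contra hlt
  push Not at hlt
  have hc : ContinuousOn (hullDist x y) (Set.Icc 0 s) :=
    hsol.locAC_hullDist.continuousOn.mono fun u hu => hu.1
  have hS : IsCompact (Set.Icc 0 s ∩ hullDist x y ⁻¹' Set.Iic h) :=
    isCompact_Icc.of_isClosed_subset (hc.preimage_isClosed_of_isClosed isClosed_Icc isClosed_Iic)
      Set.inter_subset_left
  obtain ⟨τ, hτ, hleast⟩ := hS.exists_isLeast ⟨s, ⟨hs, le_rfl⟩, hlt.le⟩
  have hbefore : ∀ u, 0 ≤ u → u < τ → h < hullDist x y u := by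
    intro u hu huτ
    by_contra hcon
    exact absurd (hleast ⟨⟨hu, huτ.le.trans hτ.1.2⟩, not_lt.1 hcon⟩) (not_le.2 huτ)
  have hτpos : 0 < τ := by
    rcases hτ.1.1.eq_or_lt with h1 | h1
    · have h2 : hullDist x y τ ≤ h := hτ.2
      rw [← h1] at h2
      linarith
    · exact h1
  have hτh : h ≤ hullDist x y τ := by
    have hct : Tendsto (hullDist x y) (𝓝[<] τ) (𝓝 (hullDist x y τ)) :=
      (hsol.locAC_hullDist.continuousAt hτpos).tendsto.mono_left nhdsWithin_le_nhds
    refine ge_of_tendsto hct ?_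
    filter_upwards [Ioo_mem_nhdsLT hτpos] with u hu
    exact (hbefore u hu.1.le hu.2).le
  have := hsol.le_hullDist_of_le hk hh hd h0 hρ (T := τ) (fun u hu huτ => ?_) hτpos.le le_rfl
  · have h2 : hullDist x y τ ≤ h := hτ.2
    linarith
  · rcases huτ.eq_or_lt with rfl | h1
    · exact hτh
    · exact (hbefore u hu h1).le

end Invariance

/-! ### Convergence of the estimates and bounds on the trajectory. -/

section Convergence

variable {n : ℕ} [NeZero n] {x : Fin n → Plane} {k α rs d h : ℝ} {y : ℝ → Plane}
  {ρh : Fin n → ℝ → ℝ}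

theorem IsSolution.locAC_bearing (hsol : IsSolution k α rs d h x y ρh) (hrs : 0 < rs)
    (hD : ∀ t, 0 ≤ t → rs ≤ hullDist x y t) (i : Fin n) :
    LocAC fun t => bearing (y t) (x i) := by
  refine LocAC.of_dist_le (f := y) hsol.absCont_agent (2 * rs⁻¹) fun s hs t _ => ?_
  have h1 : rs ≤ dist (x i) (y s) := (hD s hs).trans (infDist_convexHull_le_dist x (y s) i)
  rw [dist_eq_norm]
  refine (dist_bearing_le (ne_of_hullDist_pos (hrs.trans_le (hD s hs)) i)).trans ?_
  rw [sub_sub_sub_cancel_left, ← dist_eq_norm, dist_comm (y t)]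
  have := inv_anti₀ hrs h1
  gcongr

theorem IsSolution.locAC_estimate (hsol : IsSolution k α rs d h x y ρh) (hrs : 0 < rs)
    (hD : ∀ t, 0 ≤ t → rs ≤ hullDist x y t) (i : Fin n) :
    LocAC fun t => estimate x (y t) (fun j => ρh j t) i := by
  intro T hT
  exact (hsol.absCont_agent T hT).fun_add
    ((hsol.absCont_compensator i T hT).fun_smul (hsol.locAC_bearing hrs hD i T hT))

/-- The length of the path of an estimated target is controlled by the decrease of the estimation
error. -/
theorem IsSolution.dist_estimate_le (hsol : IsSolution k α rs d h x y ρh) (hrs : 0 < rs)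
    (hD : ∀ t, 0 ≤ t → rs ≤ hullDist x y t)
    (hρ : ∀ i t, 0 ≤ t → h ≤ ρh i t ∧ ρh i t ≤ dist (x i) (y t)) (i : Fin n) {s t : ℝ}
    (hs : 0 ≤ s) (hst : s ≤ t) :
    dist (estimate x (y s) (fun j => ρh j s) i) (estimate x (y t) (fun j => ρh j t) i) ≤
      2 * ((ρh i t - dist (x i) (y t)) - (ρh i s - dist (x i) (y s))) := by
  set X : ℝ → Plane := fun t => estimate x (y t) (fun j => ρh j t) i with hX
  -- Testing against the direction of the chord turns a bound on the speed of `X` into one on `dist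
  -- (X s) (X t)`.
  set w := bearing (X s) (X t) with hw
  have hAC : LocAC fun u => 2 * (ρh i u - dist (x i) (y u)) - ⟪w, X u⟫ :=
    ((LocAC.sub (hsol.absCont_compensator i) (hsol.locAC_dist i)).const_mul 2).sub
      ((hsol.locAC_estimate hrs hD i).inner_const w)
  have hmono : 2 * (ρh i s - dist (x i) (y s)) - ⟪w, X s⟫ ≤
      2 * (ρh i t - dist (x i) (y t)) - ⟪w, X t⟫ := by
    refine le_of_ae_deriv_nonneg (f := fun u => 2 * (ρh i u - dist (x i) (y u)) - ⟪w, X u⟫) hst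
      (hAC.mono hs hst) ?_
    filter_upwards [hsol.agent, hsol.hasDerivAt_error i] with u h1 h2 hsu _
    have hu : 0 < u := hs.trans_lt hsu
    have hne : y u ≠ x i := ne_of_hullDist_pos (hrs.trans_le (hD u hu.le)) i
    have h3 := h2 hu hne (hρ i u hu.le).1
    have h4 := hasDerivAt_bearing (h1 hu) hne
    have h5 : HasDerivAt X _ u := ((h3.smul h4).const_add (x i)).congr_of_eventuallyEq
      (Eventually.of_forall fun u => estimate_eq x (y u) (fun j => ρh j u) i)
    have h6 := (h3.const_mul 2).sub ((innerSL ℝ w).hasFDerivAt.comp_hasDerivAt u h5)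
    have h7 : deriv (fun u => 2 * (ρh i u - dist (x i) (y u)) - ⟪w, X u⟫) u = _ := h6.deriv
    rw [h7, innerSL_apply_apply]
    set v := agentVelocity k α rs d x y ρh u
    set φ := bearing (y u) (x i)
    set ρ := dist (x i) (y u)
    have hle : 0 ≤ ρ - ρh i u := sub_nonneg.2 (hρ i u hu.le).2
    set a := angularSpeed (y u) (x i) v with ha
    have ha0 : 0 ≤ a := angularSpeed_nonneg _ _ _
    -- The velocity of `X` has two parts, from the turning bearing and from the changing error; each
    -- has norm equal to the derivative of the error, whence the factor 2.
    have n1 : ‖(ρh i u - ρ) • (-(⟪rotCW φ, v⟫ / ρ) • rotCW φ)‖ = a * (ρ - ρh i u) := by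
      rw [norm_smul, norm_smul, norm_rotCW, norm_bearing hne, norm_neg, Real.norm_eq_abs,
        Real.norm_eq_abs, abs_div, abs_of_nonneg (dist_nonneg : 0 ≤ ρ), abs_sub_comm,
        abs_of_nonneg hle, ha, angularSpeed]
      ring
    have n2 : ‖(a * (ρ - ρh i u)) • φ‖ = a * (ρ - ρh i u) := by
      rw [norm_smul, norm_bearing hne, Real.norm_eq_abs, abs_of_nonneg (by positivity), mul_one]
    rw [sub_nonneg]
    refine (real_inner_le_norm _ _).trans ?_
    refine (mul_le_of_le_one_left (norm_nonneg _) (norm_bearing_le _ _)).trans ?_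
    refine (norm_add_le _ _).trans ?_
    rw [n1, n2]
    linarith
  have e : ⟪w, X t⟫ - ⟪w, X s⟫ = dist (X s) (X t) := by
    rw [← inner_sub_right]
    rcases eq_or_ne (X s) (X t) with h1 | h1
    · rw [h1]; simp
    · rw [← dist_smul_bearing (X s) (X t), inner_smul_right, real_inner_self_eq_norm_sq,
        norm_bearing h1, dist_comm]
      ring
  linarith

theorem IsSolution.error_mono (hsol : IsSolution k α rs d h x y ρh) (hrs : 0 < rs)
    (hD : ∀ t, 0 ≤ t → rs ≤ hullDist x y t)
    (hρ : ∀ i t, 0 ≤ t → h ≤ ρh i t ∧ ρh i t ≤ dist (x i) (y t)) (i : Fin n) {s t : ℝ}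
    (hs : 0 ≤ s) (hst : s ≤ t) :
    ρh i s - dist (x i) (y s) ≤ ρh i t - dist (x i) (y t) := by
  have := dist_nonneg.trans (hsol.dist_estimate_le hrs hD hρ i hs hst)
  linarith

theorem IsSolution.exists_tendsto_error (hsol : IsSolution k α rs d h x y ρh) (hrs : 0 < rs)
    (hD : ∀ t, 0 ≤ t → rs ≤ hullDist x y t)
    (hρ : ∀ i t, 0 ≤ t → h ≤ ρh i t ∧ ρh i t ≤ dist (x i) (y t)) (i : Fin n) :
    ∃ L, Tendsto (fun t => ρh i t - dist (x i) (y t)) atTop (𝓝 L) := by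
  -- Freezing time at 0 for negative arguments makes the error monotone on the whole line.
  set f : ℝ → ℝ := fun t => ρh i (max t 0) - dist (x i) (y (max t 0)) with hf
  have hmono : Monotone f := fun s t hst =>
    hsol.error_mono hrs hD hρ i (le_max_right _ _) (max_le_max_right 0 hst)
  have hbdd : BddAbove (Set.range f) := ⟨0, by
    rintro _ ⟨t, rfl⟩
    have := (hρ i (max t 0) (le_max_right _ _)).2
    simp only [hf]
    linarith⟩
  refine ⟨_, (tendsto_atTop_ciSup hmono hbdd).congr' ?_⟩
  filter_upwards [eventually_ge_atTop 0] with t ht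
  simp only [hf, max_eq_left ht]

theorem IsSolution.exists_tendsto_estimate (hsol : IsSolution k α rs d h x y ρh) (hrs : 0 < rs)
    (hD : ∀ t, 0 ≤ t → rs ≤ hullDist x y t)
    (hρ : ∀ i t, 0 ≤ t → h ≤ ρh i t ∧ ρh i t ≤ dist (x i) (y t)) (i : Fin n) :
    ∃ p, Tendsto (fun t => estimate x (y t) (fun j => ρh j t) i) atTop (𝓝 p) := by
  obtain ⟨L, hL⟩ := hsol.exists_tendsto_error hrs hD hρ i
  refine cauchySeq_tendsto_of_complete (Metric.cauchySeq_iff'.2 fun ε hε => ?_)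
  obtain ⟨N, hN⟩ := Metric.cauchySeq_iff'.1 hL.cauchySeq (ε / 4) (by positivity)
  refine ⟨max N 0, fun t ht => ?_⟩
  have h1 := hN t ((le_max_left _ _).trans ht)
  have h2 := hN (max N 0) (le_max_left _ _)
  have h3 := hsol.dist_estimate_le hrs hD hρ i (le_max_right N 0) ht
  rw [dist_comm] at h3
  rw [Real.dist_eq] at h1 h2
  linarith [(abs_lt.1 h1).2, (abs_lt.1 h2).1]

theorem IsSolution.exists_norm_le (hsol : IsSolution k α rs d h x y ρh) (hk : 0 < k) (hα : 0 < α)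
    (hd : 0 < d) (hrs : 0 < rs) (hD : ∀ t, 0 ≤ t → rs ≤ hullDist x y t)
    (hρ : ∀ i t, 0 ≤ t → h ≤ ρh i t ∧ ρh i t ≤ dist (x i) (y t)) :
    ∃ B, ∀ t, 0 ≤ t → ‖y t‖ ≤ B := by
  obtain ⟨ε, hε⟩ := (Set.finite_range fun i => dist (x i) (y 0) - ρh i 0).bddAbove
  have hest : ∀ t, 0 ≤ t → ∀ i, dist (estimate x (y t) (fun j => ρh j t) i) (x i) ≤ ε := by
    intro t ht i
    have h1 := hsol.error_mono hrs hD hρ i le_rfl ht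
    have h2 : dist (x i) (y 0) - ρh i 0 ≤ ε := hε ⟨i, rfl⟩
    have h3 := (hρ i t ht).2
    rw [estimate_eq, dist_eq_norm, add_sub_cancel_left, norm_smul, Real.norm_eq_abs,
      abs_of_nonpos (by linarith)]
    have := mul_le_of_le_one_right (show 0 ≤ -(ρh i t - dist (x i) (y t)) by linarith)
      (norm_bearing_le (y t) (x i))
    linarith
  have hr : ∀ t, 0 ≤ t → minRadius (estimate x (y t) fun j => ρh j t) ≤ minRadius x + ε :=
    fun t ht => minRadius_le_add (hest t ht)
  refine norm_le_of_circling hk hα hd hsol.absCont_agent hsol.agent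
    (C := minRadius x + ε + ε + ‖x 0‖) (fun t ht => ?_) hr fun t _ => minRadius_nonneg _
  have h1 := hest t ht 0
  have h2 := dist_minCenter_le (estimate x (y t) fun j => ρh j t) 0
  have h3 := hr t ht
  rw [dist_comm] at h2
  have h4 := dist_triangle (minCenter (estimate x (y t) fun j => ρh j t))
    (estimate x (y t) (fun j => ρh j t) 0) (x 0)
  have h5 := norm_sub_norm_le (minCenter (estimate x (y t) fun j => ρh j t)) (x 0)
  rw [← dist_eq_norm] at h5
  linarith

/-- On a bounded trajectory an estimate shrinks the vector to its target by a factor at least `h /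
(Q + B)`, so the estimated center stays uniformly ahead of the agent. -/
theorem exists_le_dist_minCenter_estimate (hh : 0 < h) (hrs : 0 < rs)
    (hD : ∀ t, 0 ≤ t → rs ≤ hullDist x y t)
    (hρ : ∀ i t, 0 ≤ t → h ≤ ρh i t ∧ ρh i t ≤ dist (x i) (y t)) {B : ℝ}
    (hB : ∀ t, 0 ≤ t → ‖y t‖ ≤ B) :
    ∃ δ > 0, ∀ t, 0 ≤ t → δ ≤ dist (minCenter (estimate x (y t) fun j => ρh j t)) (y t) := by
  obtain ⟨Q, hQ⟩ := (Set.finite_range fun i => ‖x i‖).bddAbove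
  have hP : ∀ t, 0 ≤ t → ∀ i, dist (x i) (y t) ≤ Q + B := fun t ht i => by
    rw [dist_eq_norm]
    exact (norm_sub_le _ _).trans (add_le_add (hQ ⟨i, rfl⟩) (hB t ht))
  have hPpos : 0 < Q + B :=
    (hrs.trans_le ((hD 0 le_rfl).trans (infDist_convexHull_le_dist x (y 0) 0))).trans_le
      (hP 0 le_rfl 0)
  refine ⟨h / (Q + B) * rs, by positivity, fun t ht => ?_⟩
  obtain ⟨e, he, hsup⟩ := exists_supporting_direction x (hrs.trans_le (hD t ht))
  have h1 := le_inner_minCenter_estimate he hh hrs (fun i => (hD t ht).trans (hsup i))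
    (fun i => (hρ i t ht).1) (hP t ht)
  refine h1.trans ((real_inner_le_norm _ _).trans ?_)
  rw [he, one_mul, dist_eq_norm]

end Convergence

end Circumnavigation

end

/-! ### The main theorem: identification of the limits. -/

open Circumnavigation in
theorem mainTheorem1 {n : ℕ} [NeZero n] (x : Fin n → Plane) (k α rs d h : ℝ)
    (hk : 0 < k) (hα : 0 < α) (hh : 0 < h)
    (y : ℝ → Plane) (ρh : Fin n → ℝ → ℝ)
    (hsol : IsSolution k α rs d h x y ρh)
    (hD : rs ≤ Metric.infDist (y 0) (convexHull ℝ (Set.range x)))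
    (hrs : h < rs) (hd : rs < d)
    (hρ : ∀ i, h ≤ ρh i 0 ∧ ρh i 0 ≤ dist (x i) (y 0)) :
    (∀ i, Tendsto (fun t => ρh i t - dist (x i) (y t)) atTop (𝓝 0)) ∧
    (∀ i, Tendsto (fun t => estimate x (y t) (fun j => ρh j t) i) atTop (𝓝 (x i))) ∧
    Tendsto (fun t => dist (minCenter x) (y t)) atTop (𝓝 (minRadius x + d)) ∧
    (∀ᶠ t in atTop, DifferentiableAt ℝ y t) ∧
    Tendsto (fun t => ⟪rotCW (bearing (y t) (minCenter x)), deriv y t⟫) atTop (𝓝 α) := by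
  have hrs0 : 0 < rs := hh.trans hrs
  have hd0 : 0 < d := hrs0.trans hd
  have hDt : ∀ t, 0 ≤ t → rs ≤ hullDist x y t := fun t ht =>
    hsol.le_hullDist hk hh hrs hd hD hρ ht
  have hρt : ∀ i t, 0 ≤ t → h ≤ ρh i t ∧ ρh i t ≤ dist (x i) (y t) := fun i t ht =>
    ⟨hsol.le_compensator hh (fun s hs _ => hrs.le.trans (hDt s hs)) i (hρ i).1 ht le_rfl,
      hsol.compensator_le hh (fun s hs _ => hrs.le.trans (hDt s hs)) i (hρ i).1 (hρ i).2 ht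
        le_rfl⟩
  have hyAC : LocAC y := hsol.absCont_agent
  obtain ⟨B, hB⟩ := hsol.exists_norm_le hk hα hd0 hrs0 hDt hρt
  obtain ⟨δ, hδ, hlow⟩ := exists_le_dist_minCenter_estimate hh hrs0 hDt hρt hB
  choose L hL using hsol.exists_tendsto_error hrs0 hDt hρt
  choose p hp using hsol.exists_tendsto_estimate hrs0 hDt hρt
  set xh : ℝ → Fin n → Plane := fun t => estimate x (y t) fun j => ρh j t with hxh
  have hxp : Tendsto xh atTop (𝓝 p) := tendsto_pi_nhds.2 hp
  have hxc : ContinuousOn xh (Set.Ici 0) :=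
    continuousOn_pi.2 fun i => (hsol.locAC_estimate hrs0 hDt i).continuousOn
  have hc : Tendsto (fun t => minCenter (xh t)) atTop (𝓝 (minCenter p)) :=
    (continuous_minCenter.tendsto p).comp hxp
  have hr : Tendsto (fun t => minRadius (xh t)) atTop (𝓝 (minRadius p)) :=
    (continuous_minRadius.tendsto p).comp hxp
  have hdist := tendsto_dist_of_circling hk hα hd0 hδ hyAC hsol.agent hc hr
    (fun t _ => minRadius_nonneg _) hB hlow
  have hq : Tendsto (fun t => dist (minCenter (xh t)) (y t) - minRadius (xh t)) atTop (𝓝 d) := by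
    have := ((tendsto_dist_sub (y := y) hc).add hdist).sub hr
    simpa using this
  have hvel := tendsto_circlingVelocity_sub (k := k) (α := α) hd hδ hc hlow hq
  have hRpos : 0 < minRadius p + d := add_pos_of_nonneg_of_pos (minRadius_nonneg p) hd0
  have hL0 : ∀ i, L i = 0 := by
    intro i
    by_contra hne
    -- The estimate minus `x i` is the error times the bearing; dividing by an error with nonzero
    -- limit makes the bearing converge.
    have hφ : Tendsto (fun t => bearing (y t) (x i)) atTop (𝓝 ((L i)⁻¹ • (p i - x i))) := by
      refine (((hL i).inv₀ hne).smul ((hp i).sub_const (x i))).congr' ?_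
      filter_upwards [(hL i).eventually_ne hne] with t ht
      rw [estimate_eq, add_sub_cancel_left, smul_smul, inv_mul_cancel₀ ht, one_smul]
    set φ := (L i)⁻¹ • (p i - x i) with hφdef
    have hφ1 : ‖φ‖ = 1 := by
      refine tendsto_nhds_unique hφ.norm (tendsto_const_nhds.congr' ?_)
      filter_upwards [eventually_ge_atTop 0] with t ht
      exact (norm_bearing (ne_of_hullDist_pos (hrs0.trans_le (hDt t ht)) i)).symm
    have h1 : Tendsto (fun t => ⟪rotCW φ, bearing (y t) (x i)⟫ * dist (x i) (y t)) atTop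
        (𝓝 0) := by
      have h2 : Tendsto (fun t => ⟪rotCW φ, bearing (y t) (x i)⟫) atTop (𝓝 0) := by
        simpa using (tendsto_const_nhds (x := rotCW φ)).inner (𝕜 := ℝ) hφ
      refine h2.zero_mul_isBoundedUnder_le ⟨‖x i‖ + B, ?_⟩
      rw [eventually_map]
      filter_upwards [eventually_ge_atTop 0] with t ht
      change ‖dist (x i) (y t)‖ ≤ _
      rw [Real.norm_eq_abs, abs_of_nonneg dist_nonneg, dist_eq_norm]
      exact (norm_sub_le _ _).trans (add_le_add le_rfl (hB t ht))
    -- The component of `x i - y t` orthogonal to the limit bearing vanishes because the distance is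
    -- bounded; thus one coordinate of `y` converges.
    have h3 : Tendsto (fun t => ⟪rotCW φ, y t - minCenter p⟫) atTop
        (𝓝 ⟪rotCW φ, x i - minCenter p⟫) := by
      have h4 := h1.const_sub ⟪rotCW φ, x i - minCenter p⟫
      rw [sub_zero] at h4
      refine h4.congr fun t => ?_
      rw [mul_comm, ← inner_smul_right, dist_smul_bearing, ← inner_sub_right]
      congr 1
      abel
    exact not_tendsto_inner_of_circling hα hRpos hyAC hsol.agent hB hdist hvel
      (by rw [norm_rotCW, hφ1]) h3
  have hL' : ∀ i, Tendsto (fun t => ρh i t - dist (x i) (y t)) atTop (𝓝 0) := fun i => by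
    rw [← hL0 i]; exact hL i
  have hpx : p = x := by
    funext i
    refine tendsto_nhds_unique (hp i) ?_
    have h1 : Tendsto (fun t => (ρh i t - dist (x i) (y t)) • bearing (y t) (x i)) atTop
        (𝓝 0) := by
      rw [tendsto_zero_iff_norm_tendsto_zero]
      refine squeeze_zero (fun _ => norm_nonneg _) (fun t => ?_)
        (tendsto_zero_iff_norm_tendsto_zero.1 (hL' i))
      rw [norm_smul]
      exact mul_le_of_le_one_right (norm_nonneg _) (norm_bearing_le _ _)
    have h2 := h1.const_add (x i)
    rw [add_zero] at h2
    exact h2.congr fun t => (estimate_eq x (y t) (fun j => ρh j t) i).symm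
  subst hpx
  have hder := eventually_hasDerivAt_of_circling hδ hd hyAC hsol.agent
    (continuous_minCenter.comp_continuousOn hxc) (continuous_minRadius.comp_continuousOn hxc)
    hlow hq
  refine ⟨hL', hp, hdist, hder.mono fun t ht => ht.differentiableAt, ?_⟩
  have h1 : Tendsto (fun t => ⟪rotCW (bearing (y t) (minCenter p)),
      circlingVelocity k α rs d (y t) (minCenter (xh t)) (minRadius (xh t)) -
        α • rotCW (bearing (y t) (minCenter p))⟫) atTop (𝓝 0) := by
    rw [tendsto_zero_iff_norm_tendsto_zero]
    refine squeeze_zero (fun _ => norm_nonneg _) (fun t => ?_)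
      (tendsto_zero_iff_norm_tendsto_zero.1 hvel)
    refine (norm_inner_le_norm _ _).trans
      (mul_le_of_le_one_left (norm_nonneg _) ?_)
    rw [norm_rotCW]
    exact norm_bearing_le _ _
  have h2 := h1.add_const α
  rw [zero_add] at h2
  refine h2.congr' ?_
  filter_upwards [hder, hdist.eventually_const_lt hRpos] with t ht hpos
  rw [ht.deriv, inner_sub_right, inner_smul_right, inner_rotCW_rotCW, real_inner_self_eq_norm_sq,
    norm_bearing (dist_pos.1 hpos).symm]
  ring
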